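/- Let $G$ be a finite, non-empty, simple undirected graph, let $\chi\colon V(G)\to C$ be a vertex coloring, and let $r$ be the vertex cover number of $G$, i.e. the minimal size of a set $S\subseteq V(G)$ meeting every edge. Then the Weisfeiler--Leman dimension of $(G,\chi)$ exists and is at most $\frac{2}{3}r+3$. Here, for $k\ge 1$, the $k$-dimensional Weisfeiler--Leman algorithm ($k$-WL) initially colors each tuple $\bar v\in V(G)^k$ with the isomorphism type of its ordered colored induced subgraph (the colors $\chi(v_i)$, and for which $i,j$ we have $v_i=v_j$ and $v_iv_j\in E(G)$). If $c_i$ is the coloring after $i$ rounds, then $c_{i+1}(\bar v)=(c_i(\bar v),M_i(\bar v))$, where for $k\ge 2$ \[M_i(\bar v)=\{\!\!\{(c_i(\bar v[w/1]),\dots,c_i(\bar v[w/k])) \mid w\in V(G)\}\!\!\},\] $\bar v[w/j]$ being $\bar v$ with its $j$-th entry replaced by $w$, and for $k=1$, $M_i(v)=\{\!\!\{c_i(w)\mid vw\in E(G)\}\!\!\}$. The output is $c_{i_\infty+1}$, where $i_\infty$ is the least $i$ such that $c_i$ and $c_{i+1}$ induce the same partition of $V(G)^k$. The algorithm $k$-WL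 distinguishes two colored graphs if the multisets of colors in its outputs on them differ; it identifies $(G,\chi)$ if it distinguishes $(G,\chi)$ from every finite, non-empty colored graph that is not isomorphic to it by a color-preserving isomorphism. The WL dimension of $(G,\chi)$ is the least $k\ge 1$ such that $k$-WL identifies $(G,\chi)$. -/

import Mathlib

namespace WeisfeilerLeman

universe u v w

/-- The isomorphism type of the ordered colored subgraph induced by a `k`-tuple of vertices:
the colors of the entries, the equalities and the adjacencies between them. -/
@[ext]
structure AtomicType (C : Type w) (k : ℕ) : Type w where
  color : Fin k → C
  eq : Fin k → Fin k → Prop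
  adj : Fin k → Fin k → Prop

/-- The isomorphism type of the ordered subgraph of `(G, χ)` induced by the tuple `x`. -/
def atomicType {V : Type u} {C : Type w} {k : ℕ} (G : SimpleGraph V) (χ : V → C)
    (x : Fin k → V) : AtomicType C k where
  color i := χ (x i)
  eq i j := x i = x j
  adj i j := G.Adj (x i) (x j)

/-- Two tuples have the same atomic type iff there is an isomorphism of the induced colored
graphs that maps the `i`-th entry to the `i`-th entry. -/
theorem atomicType_eq_iff {V : Type u} {W : Type v} {C : Type w} {k : ℕ}
    (G : SimpleGraph V) (χ : V → C) (H : SimpleGraph W) (ψ : W → C)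
    (x : Fin k → V) (y : Fin k → W) :
    atomicType G χ x = atomicType H ψ y ↔
      ∃ φ : G.induce (Set.range x) ≃g H.induce (Set.range y),
        (∀ i, φ ⟨x i, Set.mem_range_self i⟩ = ⟨y i, Set.mem_range_self i⟩) ∧
          ∀ z, ψ (φ z) = χ z := by
  constructor
  · intro h
    have hc : ∀ i, χ (x i) = ψ (y i) := fun i => congrFun (congrArg AtomicType.color h) i
    have he : ∀ i j, x i = x j ↔ y i = y j := fun i j =>
      iff_of_eq (congrFun (congrFun (congrArg AtomicType.eq h) i) j)
    have ha : ∀ i j, G.Adj (x i) (x j) ↔ H.Adj (y i) (y j) := fun i j =>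
      iff_of_eq (congrFun (congrFun (congrArg AtomicType.adj h) i) j)
    have hx : ∀ z : Set.range x, ∃ i, x i = z := fun z => z.2
    have hy : ∀ z : Set.range y, ∃ i, y i = z := fun z => z.2
    choose f hf using hx
    choose g hg using hy
    refine ⟨⟨⟨fun z => ⟨y (f z), Set.mem_range_self _⟩,
      fun z => ⟨x (g z), Set.mem_range_self _⟩, ?_, ?_⟩, ?_⟩, ?_, ?_⟩
    · intro z
      apply Subtype.ext
      exact ((he _ _).2 (hg _)).trans (hf z)
    · intro z
      apply Subtype.ext
      exact ((he _ _).1 (hf _)).trans (hg z)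
    · intro a b
      change H.Adj (y (f a)) (y (f b)) ↔ G.Adj a b
      rw [← ha, hf, hf]
    · intro i
      apply Subtype.ext
      exact (he _ _).1 (hf _)
    · intro z
      change ψ (y (f z)) = χ z
      rw [← hc, hf]
  · rintro ⟨φ, h1, h2⟩
    ext i j
    · have := h2 ⟨x i, Set.mem_range_self i⟩
      rw [h1] at this
      exact this.symm
    · change x i = x j ↔ y i = y j
      have := φ.injective.eq_iff (a := ⟨x i, Set.mem_range_self i⟩)
        (b := ⟨x j, Set.mem_range_self j⟩)
      rw [h1, h1, Subtype.mk.injEq, Subtype.mk.injEq] at this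
      exact this.symm
    · change G.Adj (x i) (x j) ↔ H.Adj (y i) (y j)
      have := φ.map_rel_iff (a := ⟨x i, Set.mem_range_self i⟩)
        (b := ⟨x j, Set.mem_range_self j⟩)
      rw [h1, h1] at this
      exact this.symm

/-- The colors used by the `k`-dimensional algorithm after `i` rounds. -/
def RoundColor (C : Type w) (k : ℕ) : ℕ → Type w
  | 0 => AtomicType C k
  | i + 1 => RoundColor C k i × Multiset (Fin k → RoundColor C k i)

open Classical in
/-- The coloring of `k`-tuples after `i` rounds of `k`-WL on `(G, χ)`. In a round, `x` receives
the multiset, over the vertices `z`, of the tuples of colors of `x[z/1], …, x[z/k]`; here `z`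
ranges over all vertices if `k ≥ 2`, and over the neighbors of the only entry of `x` if `k = 1`. -/
noncomputable def wlRound {V : Type u} [Fintype V] {C : Type w} (k : ℕ) (G : SimpleGraph V)
    (χ : V → C) : (i : ℕ) → (Fin k → V) → RoundColor C k i
  | 0 => atomicType G χ
  | i + 1 => fun x =>
      (wlRound k G χ i x,
        (Finset.univ.filter fun z : V => k = 1 → ∀ j, G.Adj (x j) z).val.map
          fun z j => wlRound k G χ i (Function.update x j z))

/-- `f` refines `g`. -/
def Refines {X : Type u} {A : Type v} {B : Type w} (f : X → A) (g : X → B) : Prop :=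
  ∀ x y, f x = f y → g x = g y

/-- The rounds `i` such that the colorings after `i` and after `i + 1` rounds are equivalent. -/
def stableRounds {V : Type u} [Fintype V] {C : Type w} (k : ℕ) (G : SimpleGraph V)
    (χ : V → C) : Set ℕ :=
  {i | Refines (wlRound k G χ i) (wlRound k G χ (i + 1)) ∧
    Refines (wlRound k G χ (i + 1)) (wlRound k G χ i)}

theorem stableRounds_nonempty {V : Type u} [Fintype V] {C : Type w} (k : ℕ)
    (G : SimpleGraph V) (χ : V → C) : (stableRounds k G χ).Nonempty := by
  by_contra hne
  have hlt : ∀ i, Setoid.ker (wlRound k G χ (i + 1)) < Setoid.ker (wlRound k G χ i) := by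
    intro i
    have hr : Refines (wlRound k G χ (i + 1)) (wlRound k G χ i) :=
      fun x y h => congrArg Prod.fst h
    refine lt_of_le_not_ge (fun x y h => hr x y h) fun h => hne ⟨i, fun x y hxy => h hxy, hr⟩
  have : Finite (Setoid (Fin k → V)) :=
    Finite.of_injective (fun s : Setoid (Fin k → V) => fun a b => s a b)
      fun s t h => Setoid.ext fun a b => iff_of_eq (congrFun (congrFun h a) b)
  exact not_injective_infinite_finite _
    (strictAnti_nat_of_succ_lt (f := fun i => Setoid.ker (wlRound k G χ i)) hlt).injective

/-- The least round after which the coloring is stable. -/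
noncomputable def stableRound {V : Type u} [Fintype V] {C : Type w} (k : ℕ)
    (G : SimpleGraph V) (χ : V → C) : ℕ :=
  sInf (stableRounds k G χ)

/-- The output of `k`-WL on `(G, χ)`: the coloring one round after stabilization. The colors are
tagged with their round, so that colors of different rounds are different. -/
noncomputable def wl {V : Type u} [Fintype V] {C : Type w} (k : ℕ) (G : SimpleGraph V)
    (χ : V → C) (x : Fin k → V) : Σ i, RoundColor C k i :=
  ⟨stableRound k G χ + 1, wlRound k G χ (stableRound k G χ + 1) x⟩

/-- `k`-WL distinguishes `(G, χ)` and `(H, ψ)`: the multisets of colors in the outputs differ. -/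
def Distinguishes {V : Type u} {W : Type v} [Fintype V] [Fintype W] {C : Type w} (k : ℕ)
    (G : SimpleGraph V) (χ : V → C) (H : SimpleGraph W) (ψ : W → C) : Prop :=
  (Finset.univ : Finset (Fin k → V)).val.map (wl k G χ) ≠
    (Finset.univ : Finset (Fin k → W)).val.map (wl k H ψ)

/-- Isomorphism of colored graphs. -/
def Isomorphic {V : Type u} {W : Type v} {C : Type w}
    (G : SimpleGraph V) (χ : V → C) (H : SimpleGraph W) (ψ : W → C) : Prop :=
  ∃ φ : G ≃g H, ∀ x, ψ (φ x) = χ x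

/-- `k`-WL identifies `(G, χ)`: it distinguishes it from every non-isomorphic colored graph. -/
def Identifies {V : Type u} [Fintype V] {C : Type w} (k : ℕ) (G : SimpleGraph V)
    (χ : V → C) : Prop :=
  ∀ (W : Type u) [Fintype W] [Nonempty W] (H : SimpleGraph W) (ψ : W → C),
    ¬ Isomorphic G χ H ψ → Distinguishes k G χ H ψ

/-- `d` is the WL dimension of `(G, χ)`: the least `k ≥ 1` such that `k`-WL identifies it. -/
def IsWLDimension {V : Type u} [Fintype V] {C : Type w} (G : SimpleGraph V) (χ : V → C)
    (d : ℕ) : Prop :=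
  IsLeast {k : ℕ | 1 ≤ k ∧ Identifies k G χ} d

end WeisfeilerLeman

/-! Fix a minimum vertex cover S with r elements. Individualize a set T of vertices, run color
refinement, and count the classes contained in S; there are at most r. Among the T with 3|T| at most
twice this count, take one of largest count. Then |T| ≤ 2r/3, no further vertex gains two classes
inside S, and no two further vertices gain three (`Stuck`, `exists_stuck`). It remains to see that
|T| pebbles resting on T and three moving ones identify the graph.

Being stuck is a strong rigidity. A vertex of a class inside S is joined all-or-nothing to every
other class inside S and to the rest of its own class. Any vertex splits at most one class inside S,
and there it has at most one neighbor or at most one non-neighbor (`Stuck.card_block`). A vertex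
outside S has all its neighbors in S, so individualizing it gains a class in every class it sees
that is not contained in S. Hence the edges between classes not contained in S lead from each vertex
to a single class, and form disjoint bicliques and cliques (`Stuck.inBiclique_or_inClique`). By
minimality of S, each class meeting both S and its complement has such edges (`Stuck.exists_mate`),
which forces it to be joined all-or-nothing to the classes inside S.

If H is not distinguished from G, it can be moved to the vertex set of G so that degrees into
classes, cliques and bicliques agree (`exists_pairTransfer`). An isomorphism is then glued from the
identity on classes inside S, a matching of cliques and bicliques on the mixed classes, and an
independent permutation of each remaining class (`Stuck.exists_iso`). -/

namespace WeisfeilerLeman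

universe u v w

open Finset
open scoped Classical

/-! ### Color refinement after individualization, and its classes inside S. -/

section

/-- A relation between the vertices of `G` and `H` that is a winning invariant of the bijective
two-pebble game, starting from pairs in `κ`. -/
def IsBisim {V : Type u} {W : Type v} (G : SimpleGraph V) (H : SimpleGraph W)
    (κ R : V → W → Prop) : Prop :=
  ∀ v w, R v w → κ v w ∧ ∃ f : V ≃ W, ∀ z, R z (f z) ∧ (G.Adj v z ↔ H.Adj w (f z))

/-- The largest bisimulation: indistinguishability by color refinement. -/
def Bisimilar {V : Type u} {W : Type v} (G : SimpleGraph V) (H : SimpleGraph W)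
    (κ : V → W → Prop) (v : V) (w : W) : Prop :=
  ∃ R, IsBisim G H κ R ∧ R v w

theorem isBisim_bisimilar {V : Type u} {W : Type v} (G : SimpleGraph V) (H : SimpleGraph W)
    (κ : V → W → Prop) : IsBisim G H κ (Bisimilar G H κ) := by
  rintro v w ⟨R, hR, h⟩
  obtain ⟨h1, f, hf⟩ := hR v w h
  exact ⟨h1, f, fun z => ⟨⟨R, hR, (hf z).1⟩, (hf z).2⟩⟩

theorem Bisimilar.refl {V : Type u} {G : SimpleGraph V} {κ : V → V → Prop}
    (hκ : ∀ v, κ v v) (v : V) : Bisimilar G G κ v v := by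
  refine ⟨Eq, ?_, rfl⟩
  rintro v _ rfl
  exact ⟨hκ v, Equiv.refl V, fun z => ⟨rfl, Iff.rfl⟩⟩

theorem Bisimilar.swap {V : Type u} {W : Type v} {G : SimpleGraph V} {H : SimpleGraph W}
    {κ : V → W → Prop} {κ' : W → V → Prop} (hκ : ∀ v w, κ v w → κ' w v) {v : V} {w : W}
    (h : Bisimilar G H κ v w) : Bisimilar H G κ' w v := by
  refine ⟨fun a b => Bisimilar G H κ b a, ?_, h⟩
  intro w v h
  obtain ⟨h1, f, hf⟩ := isBisim_bisimilar G H κ v w h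
  refine ⟨hκ _ _ h1, f.symm, fun z => ⟨?_, ?_⟩⟩
  · simpa using (hf (f.symm z)).1
  · simpa using (hf (f.symm z)).2.symm

theorem Bisimilar.comp {V : Type u} {W : Type v} {U : Type w} {G : SimpleGraph V}
    {H : SimpleGraph W} {K : SimpleGraph U} {κ : V → W → Prop} {κ' : W → U → Prop}
    {κ'' : V → U → Prop} (hκ : ∀ a b c, κ a b → κ' b c → κ'' a c) {a : V} {b : W} {c : U}
    (h : Bisimilar G H κ a b) (h' : Bisimilar H K κ' b c) : Bisimilar G K κ'' a c := by
  refine ⟨fun a c => ∃ b, Bisimilar G H κ a b ∧ Bisimilar H K κ' b c, ?_, b, h, h'⟩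
  rintro a c ⟨b, h, h'⟩
  obtain ⟨h1, f, hf⟩ := isBisim_bisimilar _ _ _ _ _ h
  obtain ⟨h1', f', hf'⟩ := isBisim_bisimilar _ _ _ _ _ h'
  exact ⟨hκ _ _ _ h1 h1', f.trans f', fun z => ⟨⟨f z, (hf z).1, (hf' _).1⟩,
    (hf z).2.trans (hf' _).2⟩⟩

variable {V : Type u} {C : Type w}

/-- Equality of colors when the vertices in `T` are individualized. -/
def SamePinned (χ : V → C) (T : Finset V) (v w : V) : Prop :=
  χ v = χ w ∧ ∀ t ∈ T, (v = t ↔ w = t)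

/-- The color refinement partition of `(G, χ)` after individualization of the vertices in `T`. -/
def refinement (G : SimpleGraph V) (χ : V → C) (T : Finset V) : Setoid V where
  r := Bisimilar G G (SamePinned χ T)
  iseqv :=
    { refl := Bisimilar.refl fun _ => ⟨rfl, fun _ _ => Iff.rfl⟩
      symm := Bisimilar.swap fun _ _ h => ⟨h.1.symm, fun t ht => (h.2 t ht).symm⟩
      trans := Bisimilar.comp fun _ _ _ h h' =>
        ⟨h.1.trans h'.1, fun t ht => (h.2 t ht).trans (h'.2 t ht)⟩ }

variable {G : SimpleGraph V} {χ : V → C} {S T T' : Finset V}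

theorem refinement_color {v w : V} (h : refinement G χ T v w) : χ v = χ w :=
  (isBisim_bisimilar G G _ v w h).1.1

theorem refinement_mono (hT : T ⊆ T') {v w : V} (h : refinement G χ T' v w) :
    refinement G χ T v w := by
  refine ⟨refinement G χ T', ?_, h⟩
  intro v w h
  obtain ⟨h1, f, hf⟩ := isBisim_bisimilar G G _ v w h
  exact ⟨⟨h1.1, fun t ht => h1.2 t (hT ht)⟩, f, hf⟩

theorem refinement_pinned {v t : V} (ht : t ∈ T) (h : refinement G χ T v t) : v = t :=
  ((isBisim_bisimilar G G _ v t h).1.2 t ht).2 rfl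

theorem refinement_step {v w : V} (h : refinement G χ T v w) :
    ∃ f : V ≃ V, ∀ z, refinement G χ T z (f z) ∧ (G.Adj v z ↔ G.Adj w (f z)) :=
  (isBisim_bisimilar G G _ v w h).2

/-- Union of classes of `s`. -/
def Saturated (s : Setoid V) (B : V → Prop) : Prop :=
  ∀ v w, s v w → (B v ↔ B w)

theorem Saturated.and {s : Setoid V} {A B : V → Prop} (hA : Saturated s A) (hB : Saturated s B) :
    Saturated s fun v => A v ∧ B v :=
  fun v w h => and_congr (hA v w h) (hB v w h)

theorem Saturated.not {s : Setoid V} {A : V → Prop} (hA : Saturated s A) :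
    Saturated s fun v => ¬ A v :=
  fun v w h => not_congr (hA v w h)

theorem saturated_eq {t : V} (ht : t ∈ T) : Saturated (refinement G χ T) fun v => v = t := by
  intro v w h
  constructor
  · rintro rfl
    exact refinement_pinned ht (Setoid.symm' _ h)
  · rintro rfl
    exact refinement_pinned ht h

/-- An individualized vertex is alone in its class, so the bijections of the game fix it. -/
theorem saturated_adj {t : V} (ht : t ∈ T) : Saturated (refinement G χ T) (G.Adj t) := by
  intro v w h
  obtain ⟨f, hf⟩ := refinement_step h
  have h1 : f t = t := refinement_pinned ht (Setoid.symm' _ (hf t).1)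
  have h2 := (hf t).2
  rw [h1] at h2
  rw [G.adj_comm t v, G.adj_comm t w, h2]

theorem saturated_class (hT : T ⊆ T') (a : V) :
    Saturated (refinement G χ T') (refinement G χ T a) :=
  fun _ _ h => ⟨fun h' => Setoid.trans' _ h' (refinement_mono hT h),
    fun h' => Setoid.trans' _ h' (Setoid.symm' _ (refinement_mono hT h))⟩

theorem exists_adj_of_refinement {B : V → Prop} (hB : Saturated (refinement G χ T) B) {v w : V}
    (h : refinement G χ T v w) {z : V} (hz : G.Adj v z) (hBz : B z) : ∃ y, G.Adj w y ∧ B y := by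
  obtain ⟨f, hf⟩ := refinement_step h
  exact ⟨f z, (hf z).2.1 hz, (hB _ _ (hf z).1).1 hBz⟩

/-- The class of `v` lies in `S`. -/
def Inside (s : Setoid V) (S : Finset V) (v : V) : Prop :=
  ∀ u, s v u → u ∈ S

theorem Inside.congr {s : Setoid V} {v w : V} (h : Inside s S v) (hvw : s v w) :
    Inside s S w :=
  fun u hu => h u (Setoid.trans' _ hvw hu)

theorem Inside.mem {s : Setoid V} {v : V} (h : Inside s S v) : v ∈ S :=
  h v (Setoid.refl' _ v)

theorem Inside.mono (hT : T ⊆ T') {v : V} (h : Inside (refinement G χ T) S v) :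
    Inside (refinement G χ T') S v :=
  fun u hu => h u (refinement_mono hT hu)

theorem Saturated.inside {s : Setoid V} {A : V → Prop} (hA : Saturated s A)
    (hS : ∀ v, A v → v ∈ S) {v : V} (hv : A v) : Inside s S v :=
  fun u hu => hS u ((hA v u hu).1 hv)

variable [Fintype V]

/-- The neighbors of `v` that satisfy `B`. -/
noncomputable def nbrs (G : SimpleGraph V) (v : V) (B : V → Prop) : Finset V :=
  univ.filter fun z => G.Adj v z ∧ B z

@[simp] theorem mem_nbrs {v z : V} {B : V → Prop} : z ∈ nbrs G v B ↔ G.Adj v z ∧ B z := by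
  simp [nbrs]

theorem card_nbrs_eq {B : V → Prop} (hB : Saturated (refinement G χ T) B) {v w : V}
    (h : refinement G χ T v w) : #(nbrs G v B) = #(nbrs G w B) := by
  obtain ⟨f, hf⟩ := refinement_step h
  refine card_bijective f f.bijective fun z => ?_
  rw [mem_nbrs, mem_nbrs, (hf z).2, hB _ _ (hf z).1]

theorem saturated_card_nbrs {B : V → Prop} (hB : Saturated (refinement G χ T) B) (p : ℕ → Prop) :
    Saturated (refinement G χ T) fun v => p #(nbrs G v B) :=
  fun _ _ h => iff_of_eq (congrArg p (card_nbrs_eq hB h))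

/-- The set of classes of `s` that lie in `S`. -/
noncomputable def insideClasses (s : Setoid V) (S : Finset V) : Finset (Quotient s) :=
  univ.filter fun q => ∃ v, Quotient.mk s v = q ∧ Inside s S v

theorem mk_mem_insideClasses {s : Setoid V} {v : V} :
    Quotient.mk s v ∈ insideClasses s S ↔ Inside s S v := by
  simp only [insideClasses, mem_filter, mem_univ, true_and]
  refine ⟨?_, fun h => ⟨v, rfl, h⟩⟩
  rintro ⟨w, hw, h⟩
  exact h.congr (Quotient.exact hw)

theorem card_insideClasses_le (s : Setoid V) (S : Finset V) : #(insideClasses s S) ≤ #S := by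
  have : insideClasses s S ⊆ S.image (Quotient.mk s) := by
    intro q hq
    simp only [insideClasses, mem_filter, mem_univ, true_and] at hq
    obtain ⟨v, rfl, h⟩ := hq
    exact mem_image_of_mem _ h.mem
  exact (card_le_card this).trans card_image_le

/-- Individualization gains a class inside `S` for each of the points `q i`. -/
theorem card_insideClasses_add_le (hT : T ⊆ T') {n : ℕ} (q : Fin n → V)
    (hq : ∀ i, Inside (refinement G χ T') S (q i))
    (hinj : ∀ i j, refinement G χ T' (q i) (q j) → i = j)
    (hw : ∀ p, Inside (refinement G χ T) S p →
      ∃ p', refinement G χ T p p' ∧ ∀ i, ¬ refinement G χ T' p' (q i)) :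
    #(insideClasses (refinement G χ T) S) + n ≤ #(insideClasses (refinement G χ T') S) := by
  -- Each old class inside S keeps a representative whose new class is none of those of the `q i`.
  -- These new classes are pairwise distinct and lie in S, and the classes of the `q i` come on top.
  have h1 : ∀ c : Quotient (refinement G χ T), ∃ p, c ∈ insideClasses (refinement G χ T) S →
      Quotient.mk _ p = c ∧ Inside (refinement G χ T) S p ∧
        ∀ i, ¬ refinement G χ T' p (q i) := by
    intro c
    induction c using Quotient.inductionOn with
    | h p =>
      by_cases hc : Quotient.mk _ p ∈ insideClasses (refinement G χ T) S
      swap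
      · exact ⟨p, fun h => absurd h hc⟩
      have hp := mk_mem_insideClasses.1 hc
      obtain ⟨p', h, h'⟩ := hw p hp
      exact ⟨p', fun _ => ⟨Quotient.sound (Setoid.symm' _ h), hp.congr h, h'⟩⟩
  choose rep hrep using h1
  set A := (insideClasses (refinement G χ T) S).image
    fun c => Quotient.mk (refinement G χ T') (rep c) with hA
  set B := (univ : Finset (Fin n)).image fun i => Quotient.mk (refinement G χ T') (q i) with hB
  have hcA : #A = #(insideClasses (refinement G χ T) S) := by
    refine card_image_of_injOn fun c hc d hd hcd => ?_
    rw [← (hrep c hc).1, ← (hrep d hd).1]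
    exact Quotient.sound (refinement_mono hT (Quotient.exact hcd))
  have hcB : #B = n := by
    rw [hB, card_image_of_injective _ fun i j hij => hinj i j (Quotient.exact hij), card_univ,
      Fintype.card_fin]
  have hdisj : Disjoint A B := by
    rw [disjoint_left]
    intro c hcA' hcB'
    obtain ⟨d, hd, rfl⟩ := mem_image.1 hcA'
    obtain ⟨i, -, hi⟩ := mem_image.1 hcB'
    exact (hrep d hd).2.2 i (Setoid.symm' _ (Quotient.exact hi))
  rw [← hcA, ← hcB, hcB, ← hcB, ← card_union_of_disjoint hdisj]
  refine card_le_card (union_subset ?_ ?_)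
  · intro c hc
    obtain ⟨d, hd, rfl⟩ := mem_image.1 hc
    exact mk_mem_insideClasses.2 ((hrep d hd).2.1.mono hT)
  · intro c hc
    obtain ⟨i, -, rfl⟩ := mem_image.1 hc
    exact mk_mem_insideClasses.2 (hq i)

end

/-! ### Rigidity of the classes inside S at a stuck set. -/

section

theorem subset_of_card_filter_eq {V : Type u} {P : Finset V} {A B : V → Prop}
    (hc : #(P.filter A) = #(P.filter B)) (h : ∀ z ∈ P, A z → B z) : ∀ z ∈ P, B z → A z := by
  have h1 : P.filter A ⊆ P.filter B := fun z hz => by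
    rw [mem_filter] at hz ⊢
    exact ⟨hz.1, h z hz.1 hz.2⟩
  have h2 := eq_of_subset_of_card_le h1 hc.ge
  intro z hz hBz
  have : z ∈ P.filter A := h2 ▸ mem_filter.2 ⟨hz, hBz⟩
  exact (mem_filter.1 this).2

/-- A pair-homogeneous family of blocks of a constant size between `2` and half the number of
points contains two blocks that cross. -/
theorem exists_crossing_blocks {V : Type u} {P D : Finset V} {B : V → V → Prop} {k : ℕ}
    (hk : ∀ x ∈ D, #(P.filter (B x)) = k) (h2 : 2 ≤ k) (hk2 : 2 * k ≤ #P) (hne : D.Nonempty)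
    (hpair : ∀ v ∈ P, ∀ u ∈ P, ∀ w ∈ P, u ≠ v → w ≠ v → (∃ x ∈ D, B x v ∧ B x u) →
      ∃ y ∈ D, B y v ∧ B y w) :
    ∃ x ∈ D, ∃ y ∈ D, (∃ a ∈ P, B x a ∧ B y a) ∧ (∃ a ∈ P, B x a ∧ ¬ B y a) ∧
      (∃ a ∈ P, ¬ B x a ∧ B y a) ∧ (∃ a ∈ P, ¬ B x a ∧ ¬ B y a) := by
  obtain ⟨x, hx⟩ := hne
  obtain ⟨v, hv, u, hu, hvu⟩ := one_lt_card.1 (by rw [hk x hx]; omega : 1 < #(P.filter (B x)))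
  rw [mem_filter] at hv hu
  obtain ⟨w, hw, hxw⟩ : ∃ w ∈ P, ¬ B x w := by
    by_contra! h
    have := hk x hx
    rw [filter_true_of_mem h] at this
    omega
  have hwv : w ≠ v := by
    rintro rfl
    exact hxw hv.2
  -- Some block contains the pair v, u, so by homogeneity some block contains v together with w,
  -- which the block of `x` misses.
  obtain ⟨y, hy, hyv, hyw⟩ := hpair v hv.1 u hu.1 w hw hvu.symm hwv ⟨x, hx, hv.2, hu.2⟩
  refine ⟨x, hx, y, hy, ⟨v, hv.1, hv.2, hyv⟩, ?_, ⟨w, hw, hxw, hyw⟩, ?_⟩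
  · by_contra! h
    exact hxw (subset_of_card_filter_eq ((hk x hx).trans (hk y hy).symm) h w hw hyw)
  · by_contra! h
    -- Two blocks of size k that share v cover at most 2k - 1 points, fewer than P has.
    have h1 : P ⊆ P.filter (B x) ∪ P.filter (B y) := by
      intro a ha
      rw [mem_union, mem_filter, mem_filter]
      by_cases hxa : B x a
      · exact Or.inl ⟨ha, hxa⟩
      · exact Or.inr ⟨ha, h a ha hxa⟩
    have h2 := card_le_card h1
    have h3 := card_union_add_card_inter (P.filter (B x)) (P.filter (B y))
    have h4 : 0 < #(P.filter (B x) ∩ P.filter (B y)) :=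
      card_pos.2 ⟨v, by simp [hv.1, hv.2, hyv]⟩
    rw [hk x hx, hk y hy] at h3
    omega

variable {V : Type u} [Fintype V] {C : Type w}

/-- No individualization of one vertex gains two classes inside the minimum vertex cover `S`, and
no individualization of two vertices gains three. -/
structure Stuck (G : SimpleGraph V) (χ : V → C) (S T : Finset V) : Prop where
  cover : ∀ u v, G.Adj u v → u ∉ S → v ∈ S
  minimal : ∀ S' : Finset V, (∀ u v, G.Adj u v → u ∉ S' → v ∈ S') → #S ≤ #S'
  one : ∀ x, #(insideClasses (refinement G χ (insert x T)) S) ≤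
    #(insideClasses (refinement G χ T) S) + 1
  two : ∀ x y, #(insideClasses (refinement G χ (insert x (insert y T))) S) ≤
    #(insideClasses (refinement G χ T) S) + 2

variable {G : SimpleGraph V} {χ : V → C} {S T : Finset V}

/-- The form in which stuckness is used: A and B each contribute a new class inside S, and `hw` says
that neither uses up an old class, so that both count as gains. -/
theorem Stuck.not_two (h : Stuck G χ S T) {x : V} {A B : V → Prop}
    (hA : Saturated (refinement G χ (insert x T)) A)
    (hB : Saturated (refinement G χ (insert x T)) B)
    (hAS : ∀ v, A v → v ∈ S) (hBS : ∀ v, B v → v ∈ S) (hAB : ∀ v, A v → ¬ B v)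
    {a b : V} (ha : A a) (hb : B b)
    (hw : ∀ p, Inside (refinement G χ T) S p → ∃ p', refinement G χ T p p' ∧ ¬ A p' ∧ ¬ B p') :
    False := by
  have h1 := card_insideClasses_add_le (G := G) (χ := χ) (S := S) (subset_insert x T) ![a, b]
    ?_ ?_ ?_
  · have := h.one x
    omega
  · intro i
    fin_cases i
    · exact hA.inside hAS ha
    · exact hB.inside hBS hb
  · have key : ¬ refinement G χ (insert x T) a b := fun hab => hAB b ((hA _ _ hab).1 ha) hb
    intro i j hij
    fin_cases i <;> fin_cases j
    · rfl
    · exact absurd hij key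
    · exact absurd (Setoid.symm' _ hij) key
    · rfl
  · intro p hp
    obtain ⟨p', h1, h2, h3⟩ := hw p hp
    refine ⟨p', h1, fun i => ?_⟩
    fin_cases i
    · exact fun h => h2 ((hA _ _ h).2 ha)
    · exact fun h => h3 ((hB _ _ h).2 hb)

theorem Stuck.not_three (h : Stuck G χ S T) {x y : V} {A B D : V → Prop}
    (hA : Saturated (refinement G χ (insert x (insert y T))) A)
    (hB : Saturated (refinement G χ (insert x (insert y T))) B)
    (hD : Saturated (refinement G χ (insert x (insert y T))) D)
    (hAS : ∀ v, A v → v ∈ S) (hBS : ∀ v, B v → v ∈ S) (hDS : ∀ v, D v → v ∈ S)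
    (hAB : ∀ v, A v → ¬ B v) (hAD : ∀ v, A v → ¬ D v) (hBD : ∀ v, B v → ¬ D v)
    {a b d : V} (ha : A a) (hb : B b) (hd : D d)
    (hw : ∀ p, Inside (refinement G χ T) S p →
      ∃ p', refinement G χ T p p' ∧ ¬ A p' ∧ ¬ B p' ∧ ¬ D p') :
    False := by
  have h1 := card_insideClasses_add_le (G := G) (χ := χ) (S := S)
    ((subset_insert y T).trans (subset_insert x _)) ![a, b, d] ?_ ?_ ?_
  · have := h.two x y
    omega
  · intro i
    fin_cases i
    · exact hA.inside hAS ha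
    · exact hB.inside hBS hb
    · exact hD.inside hDS hd
  · have hab : ¬ refinement G χ (insert x (insert y T)) a b :=
      fun h => hAB b ((hA _ _ h).1 ha) hb
    have had : ¬ refinement G χ (insert x (insert y T)) a d :=
      fun h => hAD d ((hA _ _ h).1 ha) hd
    have hbd : ¬ refinement G χ (insert x (insert y T)) b d :=
      fun h => hBD d ((hB _ _ h).1 hb) hd
    intro i j hij
    fin_cases i <;> fin_cases j
    · rfl
    · exact absurd hij hab
    · exact absurd hij had
    · exact absurd (Setoid.symm' _ hij) hab
    · rfl
    · exact absurd hij hbd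
    · exact absurd (Setoid.symm' _ hij) had
    · exact absurd (Setoid.symm' _ hij) hbd
    · rfl
  · intro p hp
    obtain ⟨p', h1, h2, h3, h4⟩ := hw p hp
    refine ⟨p', h1, fun i => ?_⟩
    fin_cases i
    · exact fun h => h2 ((hA _ _ h).2 ha)
    · exact fun h => h3 ((hB _ _ h).2 hb)
    · exact fun h => h4 ((hD _ _ h).2 hd)

/-- Individualizing x would cut both classes along the neighborhood of x, a gain of two. -/
theorem Stuck.not_split_two (h : Stuck G χ S T) {p q : V}
    (hp : Inside (refinement G χ T) S p) (hq : Inside (refinement G χ T) S q)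
    (hpq : ¬ refinement G χ T p q) {x a b c d : V}
    (ha : refinement G χ T p a) (hb : refinement G χ T p b)
    (hc : refinement G χ T q c) (hd : refinement G χ T q d)
    (hxa : G.Adj x a) (hxb : ¬ G.Adj x b) (hxc : G.Adj x c) (hxd : ¬ G.Adj x d) : False := by
  have hx := saturated_adj (G := G) (χ := χ) (mem_insert_self x T)
  have hcl := saturated_class (G := G) (χ := χ) (subset_insert x T)
  refine h.not_two (hx.and (hcl p)) (hx.and (hcl q)) (fun v hv => hp v hv.2)
    (fun v hv => hq v hv.2) ?_ ⟨hxa, ha⟩ ⟨hxc, hc⟩ fun z _ => ?_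
  · exact fun v hv hv' => hpq (Setoid.trans' _ hv.2 (Setoid.symm' _ hv'.2))
  · by_cases h1 : refinement G χ T p z
    · refine ⟨b, Setoid.trans' _ (Setoid.symm' _ h1) hb, fun h => hxb h.1, fun h => hxb h.1⟩
    · by_cases h2 : refinement G χ T q z
      · exact ⟨d, Setoid.trans' _ (Setoid.symm' _ h2) hd, fun h => hxd h.1, fun h => hxd h.1⟩
      · exact ⟨z, Setoid.refl' _ z, fun h => h1 h.2, fun h => h2 h.2⟩

/-- Individualizing v already gains the class of v alone, if v was not alone before; splitting the
class of p as well would be a second gain. -/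
theorem Stuck.adj_inside_iff (h : Stuck G χ S T) {v p : V}
    (hv : Inside (refinement G χ T) S v) (hp : Inside (refinement G χ T) S p)
    (hvp : ¬ refinement G χ T v p) {a b : V} (ha : refinement G χ T p a)
    (hb : refinement G χ T p b) (hva : G.Adj v a) : G.Adj v b := by
  by_contra hvb
  by_cases hs : ∃ w, refinement G χ T v w ∧ w ≠ v
  · obtain ⟨w, hvw, hwv⟩ := hs
    have hx := saturated_adj (G := G) (χ := χ) (mem_insert_self v T)
    have hcl := saturated_class (G := G) (χ := χ) (subset_insert v T)
    refine h.not_two (saturated_eq (mem_insert_self v T)) (hx.and (hcl p)) ?_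
      (fun v hv => hp v hv.2) ?_ rfl ⟨hva, ha⟩ fun z _ => ?_
    · rintro _ rfl
      exact hv.mem
    · rintro _ rfl h
      exact hvp (Setoid.symm' _ h.2)
    · by_cases h1 : refinement G χ T v z
      · exact ⟨w, Setoid.trans' _ (Setoid.symm' _ h1) hvw, hwv,
          fun h => hvp (Setoid.trans' _ hvw (Setoid.symm' _ h.2))⟩
      · by_cases h2 : refinement G χ T p z
        · refine ⟨b, Setoid.trans' _ (Setoid.symm' _ h2) hb, ?_, fun h => hvb h.1⟩
          rintro rfl
          exact hvp (Setoid.symm' _ hb)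
        · refine ⟨z, Setoid.refl' _ z, ?_, fun h => h2 h.2⟩
          rintro rfl
          exact h1 (Setoid.refl' _ _)
  · push Not at hs
    -- If v is alone in its class, the bijection matching a with b fixes v.
    obtain ⟨f, hf⟩ := refinement_step (Setoid.trans' _ (Setoid.symm' _ ha) hb)
    have h1 := (hf v).2
    rw [hs _ (hf v).1] at h1
    exact hvb (h1.1 hva.symm).symm

/-- The singleton of v is one gain; if the rest of its class fell apart, that would be a second. -/
theorem Stuck.refinement_insert (h : Stuck G χ S T) {v : V}
    (hv : Inside (refinement G χ T) S v) {a b : V} (ha : refinement G χ T v a)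
    (hb : refinement G χ T v b) (hav : a ≠ v) (hbv : b ≠ v) :
    refinement G χ (insert v T) a b := by
  by_contra hab
  refine h.not_two (A := fun z => z = v) (B := refinement G χ (insert v T) a)
    (saturated_eq (mem_insert_self v T)) (saturated_class (Subset.refl _) a) ?_ ?_ ?_ rfl
    (Setoid.refl' _ a) fun z _ => ?_
  · rintro _ rfl
    exact hv.mem
  · exact fun z hz => hv z (Setoid.trans' _ ha (refinement_mono (subset_insert v T) hz))
  · rintro _ rfl h
    exact hav (refinement_pinned (mem_insert_self _ _) h)
  · by_cases h1 : refinement G χ T v z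
    · exact ⟨b, Setoid.trans' _ (Setoid.symm' _ h1) hb, hbv, hab⟩
    · refine ⟨z, Setoid.refl' _ z, ?_, fun h =>
        h1 (Setoid.trans' _ ha (refinement_mono (subset_insert v T) h))⟩
      rintro rfl
      exact h1 (Setoid.refl' _ _)

theorem Stuck.adj_same_class_iff (h : Stuck G χ S T) {v : V}
    (hv : Inside (refinement G χ T) S v) {a b : V} (ha : refinement G χ T v a)
    (hb : refinement G χ T v b) (hav : a ≠ v) (hbv : b ≠ v) : G.Adj v a ↔ G.Adj v b :=
  saturated_adj (mem_insert_self v T) _ _ (h.refinement_insert hv ha hb hav hbv)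

/-- Individualizing x and y would cut the class of p into four parts, a gain of three. -/
theorem Stuck.not_four_cells (h : Stuck G χ S T) {p : V}
    (hp : Inside (refinement G χ T) S p) {x y a b c d : V}
    (ha : refinement G χ T p a) (hb : refinement G χ T p b)
    (hc : refinement G χ T p c) (hd : refinement G χ T p d)
    (hxa : G.Adj x a) (hya : G.Adj y a) (hxb : G.Adj x b) (hyb : ¬ G.Adj y b)
    (hxc : ¬ G.Adj x c) (hyc : G.Adj y c) (hxd : ¬ G.Adj x d) (hyd : ¬ G.Adj y d) : False := by
  have hx := saturated_adj (G := G) (χ := χ) (mem_insert_self x (insert y T))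
  have hy := saturated_adj (G := G) (χ := χ) (mem_insert_of_mem (b := x) (mem_insert_self y T))
  have hcl := saturated_class (G := G) (χ := χ)
    ((subset_insert y T).trans (subset_insert x _)) p
  refine h.not_three (hcl.and (hx.and hy)) (hcl.and (hx.and hy.not)) (hcl.and (hx.not.and hy))
    (fun v hv => hp v hv.1) (fun v hv => hp v hv.1) (fun v hv => hp v hv.1)
    (fun v h1 h2 => h2.2.2 h1.2.2) (fun v h1 h2 => h2.2.1 h1.2.1) (fun v h1 h2 => h2.2.1 h1.2.1)
    ⟨ha, hxa, hya⟩ ⟨hb, hxb, hyb⟩ ⟨hc, hxc, hyc⟩ fun z _ => ?_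
  by_cases h1 : refinement G χ T p z
  · exact ⟨d, Setoid.trans' _ (Setoid.symm' _ h1) hd, fun h => hxd h.2.1, fun h => hxd h.2.1,
      fun h => hyd h.2.2⟩
  · exact ⟨z, Setoid.refl' _ z, fun h => h1 h.1, fun h => h1 h.1, fun h => h1 h.1⟩

/-- After individualizing v, the vertices a and b are still equivalent; the bijection matching them
moves x to the required y. This is the pair-homogeneity needed in `exists_crossing_blocks`. -/
theorem Stuck.exists_common (h : Stuck G χ S T) {p : V}
    (hp : Inside (refinement G χ T) S p) {x v a b : V} (hv : refinement G χ T p v)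
    (ha : refinement G χ T p a) (hb : refinement G χ T p b) (hav : a ≠ v) (hbv : b ≠ v) :
    ∃ y, refinement G χ T x y ∧ (G.Adj x v ↔ G.Adj y v) ∧ (G.Adj x a ↔ G.Adj y b) := by
  obtain ⟨f, hf⟩ := refinement_step (h.refinement_insert (hp.congr hv)
    (Setoid.trans' _ (Setoid.symm' _ hv) ha) (Setoid.trans' _ (Setoid.symm' _ hv) hb) hav hbv)
  refine ⟨f x, refinement_mono (subset_insert v T) (hf x).1, ?_, ?_⟩
  · rw [G.adj_comm x, G.adj_comm (f x)]
    exact saturated_adj (mem_insert_self v T) _ _ (hf x).1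
  · rw [G.adj_comm x, G.adj_comm (f x)]
    exact (hf x).2

/-- A block inside a class contained in `S` has at most one element, or misses at most one. -/
theorem Stuck.card_block (h : Stuck G χ S T) {p : V} (hp : Inside (refinement G χ T) S p)
    (x : V) : #((univ.filter (refinement G χ T p)).filter (G.Adj x)) ≤ 1 ∨
      #((univ.filter (refinement G χ T p)).filter fun z => ¬ G.Adj x z) ≤ 1 := by
  by_contra! hcon
  set P := univ.filter (refinement G χ T p) with hP
  have memP : ∀ z, z ∈ P ↔ refinement G χ T p z := by simp [hP]
  have hcard : ∀ y, #(P.filter (G.Adj y)) + #(P.filter fun z => ¬ G.Adj y z) = #P :=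
    fun y => card_filter_add_card_filter_not _
  set D := univ.filter (refinement G χ T x) with hD
  have memD : ∀ z, z ∈ D ↔ refinement G χ T x z := by simp [hD]
  have hxD : D.Nonempty := ⟨x, (memD x).2 (Setoid.refl' _ x)⟩
  have hk : ∀ y ∈ D, #(P.filter (G.Adj y)) = #(P.filter (G.Adj x)) := by
    intro y hy
    have := card_nbrs_eq (saturated_class (G := G) (χ := χ) (Subset.refl T) p) ((memD y).1 hy)
    have h2 : ∀ y, P.filter (G.Adj y) = nbrs G y (refinement G χ T p) := by
      intro y
      ext z
      simp [hP, and_comm]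
    rw [h2, h2, this]
  -- Crossing blocks need size at most half of P; larger blocks are replaced by their complements,
  -- which cut P into the same four cells.
  rcases le_total (2 * #(P.filter (G.Adj x))) #P with hle | hle
  · obtain ⟨x, -, y, -, ⟨a, ha, hxa, hya⟩, ⟨b, hb, hxb, hyb⟩, ⟨c, hc, hxc, hyc⟩,
      ⟨d, hd, hxd, hyd⟩⟩ := exists_crossing_blocks hk hcon.1 hle hxD (by
        rintro v hv a ha b hb hav hbv ⟨y, hy, h1, h2⟩
        obtain ⟨z, hz, h3, h4⟩ := h.exists_common hp (x := y) ((memP v).1 hv) ((memP a).1 ha)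
          ((memP b).1 hb) hav hbv
        exact ⟨z, (memD z).2 (Setoid.trans' _ ((memD y).1 hy) hz), h3.1 h1, h4.1 h2⟩)
    rw [memP] at ha hb hc hd
    exact h.not_four_cells hp ha hb hc hd hxa hya hxb hyb hxc hyc hxd hyd
  · obtain ⟨x, -, y, -, ⟨d, hd, hxd, hyd⟩, ⟨c, hc, hxc, hyc⟩, ⟨b, hb, hxb, hyb⟩,
      ⟨a, ha, hxa, hya⟩⟩ := exists_crossing_blocks (P := P) (D := D) (B := fun y z => ¬ G.Adj y z)
      (k := #(P.filter fun z => ¬ G.Adj x z)) (by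
        intro y hy
        have h1 := hcard x
        have h2 := hcard y
        have h3 := hk y hy
        have h4 : #(P.filter fun z => ¬ G.Adj y z) = #(P.filter fun z => ¬ G.Adj x z) := by omega
        convert h4) hcon.2 (by have := hcard x; omega) hxD (by
        rintro v hv a ha b hb hav hbv ⟨y, hy, h1, h2⟩
        obtain ⟨z, hz, h3, h4⟩ := h.exists_common hp (x := y) ((memP v).1 hv) ((memP a).1 ha)
          ((memP b).1 hb) hav hbv
        exact ⟨z, (memD z).2 (Setoid.trans' _ ((memD y).1 hy) hz), fun h => h1 (h3.2 h),
          fun h => h2 (h4.2 h)⟩)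
    rw [memP] at ha hb hc hd
    exact h.not_four_cells hp ha hb hc hd (not_not.1 hxa) (not_not.1 hya) (not_not.1 hxb) hyb
      hxc (not_not.1 hyc) hxd hyd

end

/-! ### Classes not contained in S. -/

section

variable {V : Type u} {C : Type w} {G : SimpleGraph V} {χ : V → C} {S T : Finset V}

/-- The class of `v` meets both `S` and its complement. -/
def Mixed (s : Setoid V) (S : Finset V) (v : V) : Prop :=
  (∃ u, s v u ∧ u ∈ S) ∧ ∃ u, s v u ∧ u ∉ S

theorem not_inside_iff {s : Setoid V} {v : V} : ¬ Inside s S v ↔ ∃ u, s v u ∧ u ∉ S := by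
  simp [Inside]

theorem Mixed.congr {s : Setoid V} {v w : V} (h : Mixed s S v) (hvw : s v w) :
    Mixed s S w := by
  obtain ⟨⟨a, ha, ha'⟩, b, hb, hb'⟩ := h
  exact ⟨⟨a, Setoid.trans' _ (Setoid.symm' _ hvw) ha, ha'⟩, b,
    Setoid.trans' _ (Setoid.symm' _ hvw) hb, hb'⟩

theorem Mixed.not_inside {s : Setoid V} {v : V} (h : Mixed s S v) : ¬ Inside s S v :=
  not_inside_iff.2 h.2

theorem saturated_self (a : V) : Saturated (refinement G χ T) (refinement G χ T a) :=
  saturated_class (Subset.refl T) a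

variable [Fintype V]

theorem adj_of_nbrs_subset {B : V → Prop} (hB : Saturated (refinement G χ T) B) {v w : V}
    (h : refinement G χ T v w) (hs : ∀ z, B z → G.Adj v z → G.Adj w z) {z : V} (hz : B z) :
    G.Adj v z ↔ G.Adj w z := by
  refine ⟨hs z hz, fun hwz => ?_⟩
  have h1 : nbrs G v B ⊆ nbrs G w B := by
    intro y hy
    rw [mem_nbrs] at hy ⊢
    exact ⟨hs y hy.2 hy.1, hy.2⟩
  have h2 := eq_of_subset_of_card_le h1 (card_nbrs_eq hB h).ge
  have : z ∈ nbrs G v B := h2 ▸ mem_nbrs.2 ⟨hwz, hz⟩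
  exact (mem_nbrs.1 this).1

/-- A class that meets the complement of `S` has no edges to classes that avoid `S`. -/
theorem Stuck.mem_of_adj (h : Stuck G χ S T) {v c : V} (hv : ¬ Inside (refinement G χ T) S v)
    (hvc : G.Adj v c) : ∃ u, refinement G χ T c u ∧ u ∈ S := by
  obtain ⟨x, hvx, hx⟩ := not_inside_iff.1 hv
  obtain ⟨u, hxu, hu⟩ := exists_adj_of_refinement (saturated_self c) hvx hvc (Setoid.refl' _ c)
  exact ⟨u, hu, h.cover x u hxu hx⟩

theorem Stuck.mixed_of_adj (h : Stuck G χ S T) {v c : V} (hv : ¬ Inside (refinement G χ T) S v)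
    (hc : ¬ Inside (refinement G χ T) S c) (hvc : G.Adj v c) : Mixed (refinement G χ T) S c :=
  ⟨h.mem_of_adj hv hvc, not_inside_iff.1 hc⟩

/-- Take x outside S in the class of v. Its neighborhood lies in S, so its parts in the classes of y
and z become unions of classes inside S. Neither class was inside S before, so these are two gains.
-/
theorem Stuck.mate_unique (h : Stuck G χ S T) {v y z : V}
    (hv : ¬ Inside (refinement G χ T) S v) (hy : ¬ Inside (refinement G χ T) S y)
    (hz : ¬ Inside (refinement G χ T) S z) (hvy : G.Adj v y) (hvz : G.Adj v z) :
    refinement G χ T y z := by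
  obtain ⟨x, hvx, hx⟩ := not_inside_iff.1 hv
  obtain ⟨a, hxa, ha⟩ := exists_adj_of_refinement (saturated_self y) hvx hvy (Setoid.refl' _ y)
  obtain ⟨b, hxb, hb⟩ := exists_adj_of_refinement (saturated_self z) hvx hvz (Setoid.refl' _ z)
  by_contra hyz
  have hadj := saturated_adj (G := G) (χ := χ) (mem_insert_self x T)
  have hcl := saturated_class (G := G) (χ := χ) (subset_insert x T)
  refine h.not_two (hadj.and (hcl y)) (hadj.and (hcl z)) (fun u hu => h.cover x u hu.1 hx)
    (fun u hu => h.cover x u hu.1 hx) ?_ ⟨hxa, ha⟩ ⟨hxb, hb⟩ fun p hp => ?_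
  · exact fun u hu hu' => hyz (Setoid.trans' _ hu.2 (Setoid.symm' _ hu'.2))
  · exact ⟨p, Setoid.refl' _ p, fun h => hy (hp.congr (Setoid.symm' _ h.2)),
      fun h => hz (hp.congr (Setoid.symm' _ h.2))⟩

/-- For x outside S in the class of v, the neighbors in the class of y already give one gain, so x
cannot also split the class of p. -/
theorem Stuck.adj_inside_of_mixed (h : Stuck G χ S T) {v y p a b : V}
    (hv : ¬ Inside (refinement G χ T) S v) (hy : ¬ Inside (refinement G χ T) S y)
    (hvy : G.Adj v y) (hp : Inside (refinement G χ T) S p) (ha : refinement G χ T p a)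
    (hb : refinement G χ T p b) (hva : G.Adj v a) : G.Adj v b := by
  obtain ⟨x, hvx, hx⟩ := not_inside_iff.1 hv
  obtain ⟨y', hxy, hy'⟩ := exists_adj_of_refinement (saturated_self y) hvx hvy (Setoid.refl' _ y)
  obtain ⟨a', hxa, ha'⟩ := exists_adj_of_refinement (saturated_self p) hvx hva ha
  have key : ∀ z, refinement G χ T p z → G.Adj x z := by
    intro c hc
    by_contra hxc
    have hadj := saturated_adj (G := G) (χ := χ) (mem_insert_self x T)
    have hcl := saturated_class (G := G) (χ := χ) (subset_insert x T)
    refine h.not_two (hadj.and (hcl y)) (hadj.and (hcl p)) (fun u hu => h.cover x u hu.1 hx)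
      (fun u hu => h.cover x u hu.1 hx) ?_ ⟨hxy, hy'⟩ ⟨hxa, ha'⟩ fun q hq => ?_
    · exact fun u hu hu' => hy (hp.congr (Setoid.trans' _ hu'.2 (Setoid.symm' _ hu.2)))
    · by_cases h1 : refinement G χ T p q
      · exact ⟨c, Setoid.trans' _ (Setoid.symm' _ h1) hc, fun h => hxc h.1, fun h => hxc h.1⟩
      · exact ⟨q, Setoid.refl' _ q, fun h => hy (hq.congr (Setoid.symm' _ h.2)),
          fun h => h1 h.2⟩
  exact (adj_of_nbrs_subset (saturated_self p) hvx (fun z hz _ => key z hz) hb).2 (key b hb)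

theorem Stuck.exists_mate (h : Stuck G χ S T) {v : V} (hv : Mixed (refinement G χ T) S v) :
    ∃ y, G.Adj v y ∧ Mixed (refinement G χ T) S y := by
  obtain ⟨u, hvu, hu⟩ := hv.1
  by_contra! hcon
  have h1 : ∀ a b, refinement G χ T v a → G.Adj a b → Inside (refinement G χ T) S b := by
    intro a b ha hab
    by_contra hb
    obtain ⟨y, hvy, hy⟩ := exists_adj_of_refinement (saturated_self b) (Setoid.symm' _ ha) hab
      (Setoid.refl' _ b)
    exact hcon y hvy ((h.mixed_of_adj (fun h => hv.not_inside (h.congr (Setoid.symm' _ ha)))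
      hb hab).congr hy)
  -- If all neighbors of the class of v were in classes inside S, deleting this class from S would
  -- leave a smaller vertex cover.
  have h2 := h.minimal (S.filter fun z => ¬ refinement G χ T v z) (by
    intro a b hab ha
    rw [mem_filter] at ha ⊢
    by_cases ha' : refinement G χ T v a
    · have hb := h1 a b ha' hab
      exact ⟨hb.mem, fun hvb => hv.not_inside (hb.congr (Setoid.symm' _ hvb))⟩
    · have haS : a ∉ S := fun haS => ha ⟨haS, ha'⟩
      refine ⟨h.cover a b hab haS, fun hvb => haS ?_⟩
      exact (h1 b a hvb hab.symm).mem)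
  have h3 : S.filter (fun z => ¬ refinement G χ T v z) ⊂ S :=
    filter_ssubset.2 ⟨u, hu, not_not.2 hvu⟩
  exact absurd (card_lt_card h3) (not_lt.2 h2)

/-- Otherwise the neighborhoods of x and w, both contained in S, overlap properly in the class of y,
and individualizing x and w gains three classes there: both, only x, only w. -/
theorem Stuck.nbrs_eq_of_notMem (h : Stuck G χ S T) {x w y a z : V} (hx : x ∉ S) (hw : w ∉ S)
    (hxw : refinement G χ T x w) (hy : ¬ Inside (refinement G χ T) S y)
    (hya : refinement G χ T y a) (hxa : G.Adj x a) (hwa : G.Adj w a)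
    (hyz : refinement G χ T y z) : G.Adj w z ↔ G.Adj x z := by
  by_contra hcon
  have h1 : ∃ b, refinement G χ T y b ∧ G.Adj x b ∧ ¬ G.Adj w b := by
    by_contra! h1
    exact hcon (adj_of_nbrs_subset (saturated_self y) hxw h1 hyz).symm
  have h2 : ∃ b, refinement G χ T y b ∧ G.Adj w b ∧ ¬ G.Adj x b := by
    by_contra! h1
    exact hcon (adj_of_nbrs_subset (saturated_self y) (Setoid.symm' _ hxw) h1 hyz)
  obtain ⟨b, hb, hxb, hwb⟩ := h1
  obtain ⟨c, hc, hwc, hxc⟩ := h2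
  have hX := saturated_adj (G := G) (χ := χ) (mem_insert_self x (insert w T))
  have hW := saturated_adj (G := G) (χ := χ) (mem_insert_of_mem (b := x) (mem_insert_self w T))
  have hcl := saturated_class (G := G) (χ := χ)
    ((subset_insert w T).trans (subset_insert x _)) y
  refine h.not_three (hcl.and (hX.and hW)) (hcl.and (hX.and hW.not)) (hcl.and (hX.not.and hW))
    (fun v hv => h.cover x v hv.2.1 hx) (fun v hv => h.cover x v hv.2.1 hx)
    (fun v hv => h.cover w v hv.2.2 hw)
    (fun v h1 h2 => h2.2.2 h1.2.2) (fun v h1 h2 => h2.2.1 h1.2.1) (fun v h1 h2 => h2.2.1 h1.2.1)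
    ⟨hya, hxa, hwa⟩ ⟨hb, hxb, hwb⟩ ⟨hc, hxc, hwc⟩ fun p hp => ?_
  have hyp : ¬ refinement G χ T y p := fun h => hy (hp.congr (Setoid.symm' _ h))
  exact ⟨p, Setoid.refl' _ p, fun h => hyp h.1, fun h => hyp h.1, fun h => hyp h.1⟩

/-- Let `U` be the set of neighbors of `x ∉ S` in the class of `y`. A vertex of the class of `x`
outside `U` that has a neighbor in `U` has the same neighbors as `x` in the class of `y`. -/
theorem Stuck.nbrs_eq (h : Stuck G χ S T) {x w y a z : V} (hx : x ∉ S)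
    (hxw : refinement G χ T x w) (hy : ¬ Inside (refinement G χ T) S y)
    (hya : refinement G χ T y a) (hxa : G.Adj x a) (hwa : G.Adj w a)
    (hU : ¬ (G.Adj x w ∧ refinement G χ T y w))
    (hyz : refinement G χ T y z) : G.Adj w z ↔ G.Adj x z := by
  by_contra hcon
  obtain ⟨b, hb, hxb, hwb⟩ : ∃ b, refinement G χ T y b ∧ G.Adj x b ∧ ¬ G.Adj w b := by
    by_contra! h1
    exact hcon (adj_of_nbrs_subset (saturated_self y) hxw h1 hyz).symm
  have hX := saturated_adj (G := G) (χ := χ) (mem_insert_self x T)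
  have hcl := saturated_class (G := G) (χ := χ) (subset_insert x T)
  set U : V → Prop := fun v => G.Adj x v ∧ refinement G χ T y v with hUdef
  have hUs : Saturated (refinement G χ (insert x T)) U := hX.and (hcl y)
  have hcardU : #(nbrs G x U) = #(univ.filter U) := by
    congr 1
    ext v
    simp only [mem_nbrs, mem_filter, mem_univ, true_and]
    exact ⟨fun h => h.2, fun h => ⟨h.1, h⟩⟩
  -- The second gain consists of the vertices in the class of x, outside U, that see some but not
  -- all of U. By `nbrs_eq_of_notMem` a vertex outside S that sees one element of U sees all of
  -- them, so this part lies in S. It contains w, which sees a but not b.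
  refine h.not_two hUs ((hcl x).and (hUs.not.and (saturated_card_nbrs hUs
      fun n => 0 < n ∧ n < #(univ.filter U)))) (fun u hu => h.cover x u hu.1 hx) ?_
      (fun u hu hu' => hu'.2.1 hu) ⟨hxa, hya⟩ (b := w) ⟨hxw, hU, ?_, ?_⟩ fun p hp => ?_
  · rintro v ⟨hxv, -, hpos, hlt⟩
    by_contra hv
    obtain ⟨c, hc⟩ := card_pos.1 hpos
    rw [mem_nbrs] at hc
    refine absurd hlt (not_lt.2 (card_le_card fun d hd => ?_))
    rw [mem_filter] at hd
    rw [mem_nbrs]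
    exact ⟨(h.nbrs_eq_of_notMem hx hv hxv hy hc.2.2 hc.2.1 hc.1 hd.2.2).2 hd.2.1, hd.2⟩
  · exact card_pos.2 ⟨a, mem_nbrs.2 ⟨hwa, hxa, hya⟩⟩
  · refine card_lt_card ((ssubset_iff_of_subset ?_).2 ⟨b, ?_, ?_⟩)
    · intro c hc
      exact mem_filter.2 ⟨mem_univ _, (mem_nbrs.1 hc).2⟩
    · exact mem_filter.2 ⟨mem_univ _, hxb, hb⟩
    · exact fun hb' => hwb (mem_nbrs.1 hb').1
  · exact ⟨p, Setoid.refl' _ p, fun h => hy (hp.congr (Setoid.symm' _ h.2)),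
      fun h => hx (hp x (Setoid.symm' _ h.1))⟩

/-- Otherwise individualizing v gains both the singleton of v and the neighbors of v in the class of
y. -/
theorem Stuck.exists_adj_notMem (h : Stuck G χ S T) {v y : V} (hvS : v ∈ S)
    (hv : ¬ Inside (refinement G χ T) S v) (hy : ¬ Inside (refinement G χ T) S y)
    (hvy : G.Adj v y) : ∃ z, refinement G χ T y z ∧ G.Adj v z ∧ z ∉ S := by
  by_contra! hcon
  have hV := saturated_adj (G := G) (χ := χ) (mem_insert_self v T)
  have hcl := saturated_class (G := G) (χ := χ) (subset_insert v T)
  refine h.not_two (saturated_eq (mem_insert_self v T)) (hV.and (hcl y)) ?_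
    (fun u hu => hcon u hu.2 hu.1) ?_ rfl ⟨hvy, Setoid.refl' _ y⟩ fun p hp => ?_
  · rintro _ rfl
    exact hvS
  · rintro _ rfl h
    exact G.irrefl h.1
  · refine ⟨p, Setoid.refl' _ p, ?_, fun h => hy (hp.congr (Setoid.symm' _ h.2))⟩
    rintro rfl
    exact hv hp

end

/-! ### Outer edges form bicliques and cliques. -/

section

variable {V : Type u} {C : Type w}

/-- Every vertex in the class of `v` that shares a neighbor `y` with `v` has the same neighbors
as `v` in the class of `y`. -/
def InBiclique (G : SimpleGraph V) (s : Setoid V) (S : Finset V) (v : V) : Prop :=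
  ∀ z y w, s v z → ¬ Inside s S y → G.Adj v y → G.Adj z y → s y w →
    (G.Adj v w ↔ G.Adj z w)

/-- `v` has neighbors in its class, and together with them forms a clique that has no further
neighbors in this class. -/
def InClique (G : SimpleGraph V) (s : Setoid V) (v : V) : Prop :=
  (∃ z, s v z ∧ G.Adj v z) ∧ ∀ z y, s v z → G.Adj v z → s v y → y ≠ v → y ≠ z →
    (G.Adj v y ↔ G.Adj z y)

theorem InClique.of_adj {G : SimpleGraph V} {s : Setoid V} {x v : V} (h : InClique G s x)
    (hxv : s x v) (hadj : G.Adj x v) : InClique G s v := by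
  refine ⟨⟨x, Setoid.symm' _ hxv, hadj.symm⟩, fun z y hvz hadjz hvy hyv hyz => ?_⟩
  by_cases hzx : z = x
  · subst hzx
    exact (h.2 v y hxv hadj (Setoid.trans' _ hxv hvy) hyz hyv).symm
  · have hxz : s x z := Setoid.trans' _ hxv hvz
    have h1 : G.Adj x z := (h.2 v z hxv hadj hxz hzx hadjz.ne').2 hadjz
    by_cases hyx : y = x
    · subst hyx
      exact ⟨fun _ => h1.symm, fun _ => hadj.symm⟩
    · have hxy : s x y := Setoid.trans' _ hxv hvy
      exact (h.2 v y hxv hadj hxy hyx hyv).symm.trans (h.2 z y hxz h1 hxy hyx hyz)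

variable [Fintype V] {G : SimpleGraph V} {χ : V → C} {S T : Finset V}

/-- Individualizing x and a would gain a itself, its neighbors, and its non-neighbors among the
neighbors of x in the class of x. -/
theorem Stuck.adj_iff_of_common_nbr (h : Stuck G χ S T) {x a b c : V} (hx : x ∉ S)
    (ha : refinement G χ T x a) (hb : refinement G χ T x b) (hc : refinement G χ T x c)
    (hxa : G.Adj x a) (hxb : G.Adj x b) (hxc : G.Adj x c) (hca : c ≠ a) (hab : G.Adj a b) :
    G.Adj a c := by
  by_contra hac
  have hX := saturated_adj (G := G) (χ := χ) (mem_insert_self x (insert a T))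
  have ha' : a ∈ insert x (insert a T) := mem_insert_of_mem (mem_insert_self a T)
  have hA := saturated_adj (G := G) (χ := χ) ha'
  have hE := saturated_eq (G := G) (χ := χ) ha'
  have hcl := saturated_class (G := G) (χ := χ)
    ((subset_insert a T).trans (subset_insert x _)) x
  refine h.not_three hE ((hcl.and hX).and hA) ((hcl.and hX).and (hA.not.and hE.not)) ?_
    (fun v hv => h.cover x v hv.1.2 hx) (fun v hv => h.cover x v hv.1.2 hx) ?_
    (fun v h1 h2 => h2.2.2 h1) (fun v h1 h2 => h2.2.1 h1.2) rfl ⟨⟨hb, hxb⟩, hab⟩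
    ⟨⟨hc, hxc⟩, hac, hca⟩ fun p hp => ?_
  · rintro _ rfl
    exact h.cover x _ hxa hx
  · rintro _ rfl h
    exact G.irrefl h.2
  · have hxp : ¬ refinement G χ T x p := fun h => hx (hp x (Setoid.symm' _ h))
    refine ⟨p, Setoid.refl' _ p, ?_, fun h => hxp h.1.1, fun h => hxp h.1.1⟩
    rintro rfl
    exact hxp ha

/-- The neighbors of x in its own class are either independent, and `nbrs_eq` applies, or one edge
among them makes them a clique. -/
theorem Stuck.inBiclique_or_inClique_of_notMem (h : Stuck G χ S T) {x a : V} (hx : x ∉ S)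
    (hxa : refinement G χ T x a) (hadj : G.Adj x a) :
    InBiclique G (refinement G χ T) S x ∨ InClique G (refinement G χ T) x := by
  have hx' : ∀ {y}, refinement G χ T x y → ¬ Inside (refinement G χ T) S y :=
    fun hy hy' => hx (hy' x (Setoid.symm' _ hy))
  by_cases hU : ∃ b c, refinement G χ T x b ∧ refinement G χ T x c ∧ G.Adj x b ∧ G.Adj x c ∧
      G.Adj b c
  · right
    obtain ⟨b, c, hb, hc, hxb, hxc, hbc⟩ := hU
    have key : ∀ d e, refinement G χ T x d → refinement G χ T x e → G.Adj x d → G.Adj x e →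
        d ≠ e → G.Adj d e := by
      intro d e hd he hxd hxe hde
      by_cases hdb : d = b
      · subst hdb
        exact h.adj_iff_of_common_nbr hx hd hc he hxd hxc hxe hde.symm hbc
      · have hbd := h.adj_iff_of_common_nbr hx hb hc hd hxb hxc hxd hdb hbc
        exact h.adj_iff_of_common_nbr hx hd hb he hxd hxb hxe hde.symm hbd.symm
    refine ⟨⟨a, hxa, hadj⟩, fun z y hz hxz hy hyx hyz => ?_⟩
    refine ⟨fun hxy => key z y hz hy hxz hxy hyz.symm, fun hzy => ?_⟩
    have hcard := card_nbrs_eq (saturated_self (G := G) (χ := χ) (T := T) x) hz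
    -- The clique accounts for the full degree of z within the class, so z has no further neighbors
    -- there.
    have hsub : insert x ((nbrs G x (refinement G χ T x)).erase z) ⊆
        nbrs G z (refinement G χ T x) := by
      intro d hd
      rw [mem_insert, mem_erase, mem_nbrs] at hd
      rw [mem_nbrs]
      rcases hd with rfl | ⟨hdz, hxd, hd⟩
      · exact ⟨hxz.symm, Setoid.refl' _ _⟩
      · exact ⟨key z d hz hd hxz hxd hdz.symm, hd⟩
    have heq := eq_of_subset_of_card_le hsub (by
      rw [card_insert_of_notMem (by simp), card_erase_of_mem (mem_nbrs.2 ⟨hxz, hz⟩), ← hcard]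
      omega)
    have hmem : y ∈ insert x ((nbrs G x (refinement G χ T x)).erase z) := by
      rw [heq]
      exact mem_nbrs.2 ⟨hzy, hy⟩
    rw [mem_insert, mem_erase, mem_nbrs] at hmem
    exact (hmem.resolve_left hyx).2.1
  · left
    push Not at hU
    intro z y y' hz hy hxy hzy hyy'
    have hxy' : refinement G χ T x y :=
      Setoid.trans' _ hxa (h.mate_unique (hx' (Setoid.refl' _ x)) (hx' hxa) hy hadj hxy)
    refine (h.nbrs_eq hx hz hy (Setoid.refl' _ y) hxy hzy ?_ hyy').symm
    exact fun hxz => hU y z hxy' hz hxy hxz.1 hzy.symm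

theorem Stuck.inBiclique_of_not_adj (h : Stuck G χ S T) {v : V}
    (hv : ¬ Inside (refinement G χ T) S v) (hn : ∀ z, refinement G χ T v z → ¬ G.Adj v z) :
    InBiclique G (refinement G χ T) S v := by
  intro z y y' hz hy hvy hzy hyy'
  have hyv : ¬ refinement G χ T v y := fun h => hn y h hvy
  by_cases hvS : v ∈ S
  -- For v in S, `nbrs_eq` is applied from the other side, at a neighbor of v outside S.
  · obtain ⟨y₀, hy₀, hvy₀, hy₀S⟩ := h.exists_adj_notMem hvS hv hy hvy
    have key : ∀ w, refinement G χ T y w → G.Adj v w → ∀ z, refinement G χ T v z →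
        (G.Adj w z ↔ G.Adj y₀ z) := fun w hw hvw z hz =>
      h.nbrs_eq hy₀S (Setoid.trans' _ (Setoid.symm' _ hy₀) hw) hv (Setoid.refl' _ v) hvy₀.symm
        hvw.symm (fun h => hyv (Setoid.trans' _ h.2 (Setoid.symm' _ hw))) hz
    have hz₀ : G.Adj y₀ z := (key y (Setoid.refl' _ y) hvy z hz).1 hzy.symm
    exact adj_of_nbrs_subset (saturated_self y) hz
      (fun w hw hvw => ((key w hw hvw z hz).2 hz₀).symm) hyy'
  · refine (h.nbrs_eq hvS hz hy (Setoid.refl' _ y) hvy hzy ?_ hyy').symm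
    exact fun h => hyv (Setoid.trans' _ hz (Setoid.symm' _ h.2))

/-- The edges between vertices whose classes are not contained in `S` form complete bipartite
graphs and cliques. -/
theorem Stuck.inBiclique_or_inClique (h : Stuck G χ S T) {v : V}
    (hv : ¬ Inside (refinement G χ T) S v) :
    InBiclique G (refinement G χ T) S v ∨ InClique G (refinement G χ T) v := by
  by_cases hn : ∃ z, refinement G χ T v z ∧ G.Adj v z
  swap
  · push Not at hn
    exact Or.inl (h.inBiclique_of_not_adj hv hn)
  obtain ⟨a, ha, hva⟩ := hn
  have hv' : ∀ {y}, refinement G χ T v y → ¬ Inside (refinement G χ T) S y :=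
    fun hy hy' => hv (hy'.congr (Setoid.symm' _ hy))
  by_cases hvS : v ∈ S
  swap
  · exact h.inBiclique_or_inClique_of_notMem hvS ha hva
  -- The vertex x is a neighbor of v in the same class and outside S; its type, already known,
  -- passes to v.
  obtain ⟨x, hax, hvx, hx⟩ := h.exists_adj_notMem hvS hv (hv' ha) hva
  have hxv : refinement G χ T x v := Setoid.symm' _ (Setoid.trans' _ ha hax)
  rcases h.inBiclique_or_inClique_of_notMem hx hxv hvx.symm with hB | hK
  · left
    intro z y y' hz hy hvy hzy hyy'
    have hvy' : refinement G χ T v y :=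
      Setoid.trans' _ ha (h.mate_unique hv (hv' ha) hy hva hvy)
    have key : ∀ w, refinement G χ T v w → G.Adj v w → ∀ z, refinement G χ T v z →
        (G.Adj x z ↔ G.Adj w z) := fun w hw hvw z hz =>
      hB w v z (Setoid.trans' _ hxv hw) hv hvx.symm hvw.symm hz
    have hxz : G.Adj x z := (key y hvy' hvy z hz).2 hzy.symm
    exact adj_of_nbrs_subset (saturated_self v) hz
      (fun w hw hvw => ((key w hw hvw z hz).1 hxz).symm) (Setoid.trans' _ hvy' hyy')
  · exact Or.inr (hK.of_adj hxv hvx.symm)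

end

/-! ### Gluing isomorphic components to a permutation. -/

section

variable {V : Type u} {K : Type w}

theorem exists_bijOn_of_card_eq {A B : Finset V} (h : #A = #B) :
    ∃ φ : V → V, Set.BijOn φ A B := by
  obtain ⟨e⟩ : Nonempty (A ≃ B) := Fintype.card_eq.1 (by simpa using h)
  refine ⟨fun v => if hv : v ∈ A then e ⟨v, hv⟩ else v, ?_, ?_, ?_⟩
  · intro v hv
    rw [mem_coe] at hv
    simp only [hv, dif_pos]
    exact (e ⟨v, hv⟩).2
  · intro v hv w hw hvw
    rw [mem_coe] at hv hw
    simp only [hv, hw, dif_pos] at hvw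
    simpa using e.injective (Subtype.ext hvw)
  · intro w hw
    refine ⟨e.symm ⟨w, hw⟩, (e.symm ⟨w, hw⟩).2, ?_⟩
    simp

/-- `A` is the component of `v` in the graph of the symmetric relation `r`. -/
structure IsComponent (r : V → V → Prop) (A : Finset V) (v : V) : Prop where
  mem : v ∈ A
  closed : ∀ a b, a ∈ A → r a b → b ∈ A
  least : ∀ D : Finset V, (∀ a b, a ∈ D → r a b → b ∈ D) → v ∈ D → A ⊆ D

theorem isComponent_singleton {r : V → V → Prop} {v : V} (hv : ∀ y, ¬ r v y) :
    IsComponent r {v} v := by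
  refine ⟨mem_singleton_self v, fun a b ha hab => ?_, fun D _ hvD => singleton_subset_iff.2 hvD⟩
  rw [mem_singleton] at ha
  subst ha
  exact absurd hab (hv b)

variable {r r' : V → V → Prop} {c : V → K}

/-- The components of `v` for `r` and of `w` for `r'` are isomorphic. -/
def ComponentsMatch (r r' : V → V → Prop) (c : V → K) (v w : V) : Prop :=
  ∃ (A A' : Finset V) (φ : V → V), IsComponent r A v ∧ IsComponent r' A' w ∧
    Set.BijOn φ A A' ∧ (∀ a ∈ A, c (φ a) = c a) ∧
    ∀ a ∈ A, ∀ b ∈ A, (r a b ↔ r' (φ a) (φ b))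

/-- Peel off one component at a time: a vertex of D has a partner of the same color in D', their
components match, and removing both keeps the color counts equal. -/
theorem exists_injOn_of_componentsMatch (hr : ∀ a b, r a b → r b a) (hr' : ∀ a b, r' a b → r' b a)
    (hm : ∀ v w, c v = c w → ComponentsMatch r r' c v w) (n : ℕ) :
    ∀ D D' : Finset V, #D = n → (∀ a b, a ∈ D → r a b → b ∈ D) →
      (∀ a b, a ∈ D' → r' a b → b ∈ D') →
      (∀ q, #(D.filter fun v => c v = q) = #(D'.filter fun v => c v = q)) →
      ∃ φ : V → V, Set.MapsTo φ D D' ∧ Set.InjOn φ D ∧ (∀ a ∈ D, c (φ a) = c a) ∧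
        ∀ a ∈ D, ∀ b ∈ D, (r a b ↔ r' (φ a) (φ b)) := by
  induction n using Nat.strong_induction_on with
  | _ n ih =>
    intro D D' hn hD hD' hc
    rcases D.eq_empty_or_nonempty with rfl | ⟨v, hv⟩
    · exact ⟨id, fun a ha => absurd ha (by simp), by simp, by simp, by simp⟩
    obtain ⟨w, hw⟩ : (D'.filter fun w => c w = c v).Nonempty := by
      rw [← card_pos, ← hc]
      exact card_pos.2 ⟨v, mem_filter.2 ⟨hv, rfl⟩⟩
    rw [mem_filter] at hw
    obtain ⟨A, A', φ, hA, hA', hφ, hcφ, hrφ⟩ := hm v w hw.2.symm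
    have hAD := hA.least D hD hv
    have hAD' := hA'.least D' hD' hw.1
    have hcA : ∀ q, #(A.filter fun v => c v = q) = #(A'.filter fun v => c v = q) := by
      intro q
      refine card_bij (fun a _ => φ a) ?_ ?_ ?_
      · intro a ha
        rw [mem_filter] at ha ⊢
        exact ⟨hφ.mapsTo ha.1, (hcφ a ha.1).trans ha.2⟩
      · intro a ha b hb hab
        rw [mem_filter] at ha hb
        exact hφ.injOn ha.1 hb.1 hab
      · intro b hb
        rw [mem_filter] at hb
        obtain ⟨a, ha, rfl⟩ := hφ.surjOn hb.1
        exact ⟨a, mem_filter.2 ⟨ha, (hcφ a ha).symm.trans hb.2⟩, rfl⟩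
    have hfilter : ∀ (X Y : Finset V) (q : K), X ⊆ Y →
        #((Y \ X).filter fun v => c v = q) + #(X.filter fun v => c v = q) =
          #(Y.filter fun v => c v = q) := by
      intro X Y q hXY
      rw [← card_union_of_disjoint (disjoint_filter_filter sdiff_disjoint), ← filter_union,
        sdiff_union_of_subset hXY]
    obtain ⟨ψ, hψm, hψi, hcψ, hrψ⟩ := ih #(D \ A)
      (by
        rw [← hn]
        exact card_lt_card (sdiff_ssubset hAD ⟨v, hA.mem⟩))
      (D \ A) (D' \ A') rfl
      (by
        intro a b ha hab
        rw [mem_sdiff] at ha ⊢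
        exact ⟨hD a b ha.1 hab, fun hb => ha.2 (hA.closed b a hb (hr _ _ hab))⟩)
      (by
        intro a b ha hab
        rw [mem_sdiff] at ha ⊢
        exact ⟨hD' a b ha.1 hab, fun hb => ha.2 (hA'.closed b a hb (hr' _ _ hab))⟩)
      (by
        intro q
        have h1 := hfilter A D q hAD
        have h2 := hfilter A' D' q hAD'
        have h3 := hc q
        have h4 := hcA q
        omega)
    have hψ' : ∀ a ∈ D, a ∉ A → ψ a ∈ D' ∧ ψ a ∉ A' := by
      intro a ha haA
      have := hψm (mem_coe.2 (mem_sdiff.2 ⟨ha, haA⟩))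
      rwa [mem_coe, mem_sdiff] at this
    refine ⟨fun a => if a ∈ A then φ a else ψ a, ?_, ?_, ?_, ?_⟩
    · intro a ha
      dsimp only
      split_ifs with haA
      · exact hAD' (hφ.mapsTo haA)
      · exact (hψ' a ha haA).1
    · intro a ha b hb hab
      dsimp only at hab
      split_ifs at hab with haA hbA hbA
      · exact hφ.injOn haA hbA hab
      · exact absurd (hab ▸ hφ.mapsTo haA) (hψ' b hb hbA).2
      · exact absurd (hab ▸ hφ.mapsTo hbA) (hψ' a ha haA).2
      · exact hψi (mem_coe.2 (mem_sdiff.2 ⟨ha, haA⟩)) (mem_coe.2 (mem_sdiff.2 ⟨hb, hbA⟩)) hab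
    · intro a ha
      dsimp only
      split_ifs with haA
      · exact hcφ a haA
      · exact hcψ a (mem_sdiff.2 ⟨ha, haA⟩)
    · intro a ha b hb
      dsimp only
      split_ifs with haA hbA hbA
      · exact hrφ a haA b hbA
      · exact iff_of_false (fun h => hbA (hA.closed a b haA h))
          fun h => (hψ' b hb hbA).2 (hA'.closed _ _ (hφ.mapsTo haA) h)
      · exact iff_of_false (fun h => haA (hA.closed b a hbA (hr _ _ h)))
          fun h => (hψ' a ha haA).2 (hA'.closed _ _ (hφ.mapsTo hbA) (hr' _ _ h))
      · exact hrψ a (mem_sdiff.2 ⟨ha, haA⟩) b (mem_sdiff.2 ⟨hb, hbA⟩)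

variable [Fintype V]

theorem exists_equiv_of_card_fiber_eq {W : Type v} [Fintype W] {f : V → K} {g : W → K}
    (h : ∀ q, #(univ.filter fun v => f v = q) = #(univ.filter fun w => g w = q)) :
    ∃ π : V ≃ W, ∀ v, g (π v) = f v := by
  have e : ∀ q, Nonempty ({v // f v = q} ≃ {w // g w = q}) := fun q =>
    Fintype.card_eq.1 (by rw [Fintype.card_subtype, Fintype.card_subtype, h q])
  replace e := fun q => (e q).some
  refine ⟨(Equiv.sigmaFiberEquiv f).symm.trans
    ((Equiv.sigmaCongrRight e).trans (Equiv.sigmaFiberEquiv g)), fun v => ?_⟩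
  exact (e (f v) ⟨v, rfl⟩).2

theorem exists_perm_of_componentsMatch (hr : ∀ a b, r a b → r b a) (hr' : ∀ a b, r' a b → r' b a)
    (hm : ∀ v w, c v = c w → ComponentsMatch r r' c v w) :
    ∃ π : Equiv.Perm V, (∀ v, c (π v) = c v) ∧ ∀ a b, r a b ↔ r' (π a) (π b) := by
  obtain ⟨φ, -, hi, hc, hφ⟩ := exists_injOn_of_componentsMatch hr hr' hm _ univ univ rfl
    (by simp) (by simp) (fun _ => rfl)
  have hinj : Function.Injective φ := fun a b h => hi (by simp) (by simp) h
  exact ⟨Equiv.ofBijective φ (Finite.injective_iff_bijective.1 hinj), fun v => hc v (mem_univ v),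
    fun a b => hφ a (mem_univ a) b (mem_univ b)⟩

end

/-! ### Transfer of cliques and bicliques from G to H by three pebbles. -/

section

variable {V : Type u}

/-- `G` and `H` agree, up to `s`, in the bijective game with three pebbles, started with one
pebble on the same vertex in both graphs. -/
def PairTransfer (s : Setoid V) (G H : SimpleGraph V) : Prop :=
  ∀ v, ∃ g : V ≃ V, ∀ z, s z (g z) ∧ (G.Adj v z ↔ H.Adj v (g z)) ∧
    ∃ h : V ≃ V, ∀ y, s y (h y) ∧ (y = v ↔ h y = v) ∧ (y = z ↔ h y = g z) ∧
      (G.Adj v y ↔ H.Adj v (h y)) ∧ (G.Adj z y ↔ H.Adj (g z) (h y))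

variable {s : Setoid V} {G H : SimpleGraph V} {S : Finset V}

theorem PairTransfer.symm (ht : PairTransfer s G H) : PairTransfer s H G := by
  intro v
  obtain ⟨g, hg⟩ := ht v
  refine ⟨g.symm, fun z => ?_⟩
  obtain ⟨h1, h2, h, hh⟩ := hg (g.symm z)
  rw [g.apply_symm_apply] at h1 h2
  refine ⟨Setoid.symm' _ h1, h2.symm, h.symm, fun y => ?_⟩
  obtain ⟨k1, k2, k3, k4, k5⟩ := hh (h.symm y)
  rw [h.apply_symm_apply] at k1 k2 k3 k4 k5
  rw [g.apply_symm_apply] at k3 k5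
  exact ⟨Setoid.symm' _ k1, k2.symm, k3.symm, k4.symm, k5.symm⟩

theorem PairTransfer.exists_adj (ht : PairTransfer s G H) {v z : V} (h : H.Adj v z) :
    ∃ y, s z y ∧ G.Adj v y := by
  obtain ⟨g, hg⟩ := ht v
  obtain ⟨h1, h2, -⟩ := hg (g.symm z)
  rw [g.apply_symm_apply] at h1 h2
  exact ⟨g.symm z, Setoid.symm' _ h1, h2.2 h⟩

/-- The bijection for the third pebble depends only on v and z, so it handles y and its competitor
in the same class simultaneously. -/
theorem PairTransfer.inBiclique (ht : PairTransfer s G H) {v : V} (hv : InBiclique G s S v) :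
    InBiclique H s S v := by
  intro z y y' hz hy hvy hzy hyy'
  obtain ⟨g, hg⟩ := ht v
  obtain ⟨h1, h2, h, hh⟩ := hg (g.symm z)
  rw [g.apply_symm_apply] at h1 h2
  obtain ⟨a1, -, -, a2, a3⟩ := hh (h.symm y)
  obtain ⟨b1, -, -, b2, b3⟩ := hh (h.symm y')
  rw [h.apply_symm_apply] at a1 a2 a3 b1 b2 b3
  rw [g.apply_symm_apply] at a3 b3
  rw [← b2, ← b3]
  exact hv _ _ _ (Setoid.trans' _ hz (Setoid.symm' _ h1)) (fun hi => hy (hi.congr a1))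
    (a2.2 hvy) (a3.2 hzy) (Setoid.trans' _ a1 (Setoid.trans' _ hyy' (Setoid.symm' _ b1)))

theorem PairTransfer.inClique (ht : PairTransfer s G H) {v : V} (hv : InClique G s v) :
    InClique H s v := by
  refine ⟨?_, ?_⟩
  · obtain ⟨z, hz, hvz⟩ := hv.1
    obtain ⟨y, hy, hvy⟩ := ht.symm.exists_adj hvz
    exact ⟨y, Setoid.trans' _ hz hy, hvy⟩
  intro z y hz hvz hy hyv hyz
  obtain ⟨g, hg⟩ := ht v
  obtain ⟨h1, h2, h, hh⟩ := hg (g.symm z)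
  rw [g.apply_symm_apply] at h1 h2
  obtain ⟨a1, a2, a3, a4, a5⟩ := hh (h.symm y)
  rw [h.apply_symm_apply] at a1 a2 a3 a4 a5
  rw [g.apply_symm_apply] at a3 a5
  rw [← a4, ← a5]
  exact hv.2 _ _ (Setoid.trans' _ hz (Setoid.symm' _ h1)) (h2.2 hvz)
    (Setoid.trans' _ hy (Setoid.symm' _ a1)) (fun h => hyv (a2.1 h)) (fun h => hyz (a3.1 h))

/-- The edges between vertices whose classes are not contained in `S`. -/
def OuterAdj (F : SimpleGraph V) (s : Setoid V) (S : Finset V) (a b : V) : Prop :=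
  F.Adj a b ∧ ¬ Inside s S a ∧ ¬ Inside s S b

theorem OuterAdj.symm {F : SimpleGraph V} {a b : V} (h : OuterAdj F s S a b) :
    OuterAdj F s S b a :=
  ⟨h.1.symm, h.2.2, h.2.1⟩

/-- Every vertex has outer neighbors in at most one class. -/
def UniqueMates (F : SimpleGraph V) (s : Setoid V) (S : Finset V) : Prop :=
  ∀ v y z, OuterAdj F s S v y → OuterAdj F s S v z → s y z

theorem PairTransfer.uniqueMates (ht : PairTransfer s G H) (hG : UniqueMates G s S) :
    UniqueMates H s S := by
  intro v y z hy hz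
  obtain ⟨y', hyy', hvy⟩ := ht.exists_adj hy.1
  obtain ⟨z', hzz', hvz⟩ := ht.exists_adj hz.1
  have := hG v y' z' ⟨hvy, hy.2.1, fun h => hy.2.2 (h.congr (Setoid.symm' _ hyy'))⟩
    ⟨hvz, hz.2.1, fun h => hz.2.2 (h.congr (Setoid.symm' _ hzz'))⟩
  exact Setoid.trans' _ hyy' (Setoid.trans' _ this (Setoid.symm' _ hzz'))

variable [Fintype V] {F : SimpleGraph V}

theorem PairTransfer.card_nbrs_eq (ht : PairTransfer s G H) (v : V) {B : V → Prop}
    (hB : Saturated s B) : #(nbrs G v B) = #(nbrs H v B) := by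
  obtain ⟨g, hg⟩ := ht v
  refine card_bijective g g.bijective fun z => ?_
  rw [mem_nbrs, mem_nbrs, (hg z).2.1, hB _ _ (hg z).1]

theorem isComponent_clique (hF : UniqueMates F s S) {v : V} (hv : ¬ Inside s S v)
    (hK : InClique F s v) : IsComponent (OuterAdj F s S) (insert v (nbrs F v (s v))) v := by
  refine ⟨mem_insert_self _ _, fun a b ha hab => ?_, fun D hD hvD => ?_⟩
  · rw [mem_insert, mem_nbrs] at ha ⊢
    have hva : s v a := by
      rcases ha with rfl | ha
      · exact Setoid.refl' _ _
      · exact ha.2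
    have hKa : InClique F s a := by
      rcases ha with rfl | ha
      · exact hK
      · exact hK.of_adj ha.2 ha.1
    obtain ⟨c, hac, hadj⟩ := hKa.1
    have hvb : s v b := Setoid.trans' _ hva (Setoid.trans' _ hac (hF a c b
      ⟨hadj, hab.2.1, fun h => hab.2.1 (h.congr (Setoid.symm' _ hac))⟩ hab))
    rcases ha with rfl | ha
    · exact Or.inr ⟨hab.1, hvb⟩
    · by_cases hbv : b = v
      · exact Or.inl hbv
      · exact Or.inr ⟨(hK.2 a b hva ha.1 hvb hbv hab.1.ne').2 hab.1, hvb⟩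
  · intro a ha
    rw [mem_insert, mem_nbrs] at ha
    rcases ha with rfl | ha
    · exact hvD
    · exact hD v a hvD ⟨ha.1, hv, fun h => hv (h.congr (Setoid.symm' _ ha.2))⟩

theorem adj_iff_ne_of_inClique {v a b : V} (hK : InClique F s v)
    (ha : a ∈ insert v (nbrs F v (s v))) (hb : b ∈ insert v (nbrs F v (s v))) :
    F.Adj a b ↔ a ≠ b := by
  refine ⟨fun h => h.ne, fun hab => ?_⟩
  rw [mem_insert, mem_nbrs] at ha hb
  rcases ha with rfl | ha
  · exact (hb.resolve_left hab.symm).1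
  · rcases hb with rfl | hb
    · exact ha.1.symm
    · exact (hK.2 a b ha.2 ha.1 hb.2 hb.1.ne' hab.symm).1 hb.1

theorem disjoint_biclique {v y : V} (hvy : OuterAdj F s S v y) (hB : InBiclique F s S v) :
    Disjoint (nbrs F v (s y)) (nbrs F y (s v)) := by
  rw [disjoint_left]
  intro a ha ha'
  rw [mem_nbrs] at ha ha'
  exact F.irrefl ((hB a y a ha'.2 hvy.2.2 hvy.1 ha'.1.symm ha.2).1 ha.1)

theorem isComponent_biclique (hF : UniqueMates F s S) {v y : V} (hvy : OuterAdj F s S v y)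
    (hB : InBiclique F s S v) :
    IsComponent (OuterAdj F s S) (nbrs F v (s y) ∪ nbrs F y (s v)) v := by
  obtain ⟨hadj, hv, hy⟩ := hvy
  refine ⟨mem_union_right _ (mem_nbrs.2 ⟨hadj.symm, Setoid.refl' _ v⟩), fun a b ha hab => ?_,
    fun D hD hvD => ?_⟩
  · rw [mem_union, mem_nbrs, mem_nbrs] at ha ⊢
    rcases ha with ha | ha
    · have hvb : s v b := hF a v b ⟨ha.1.symm, hab.2.1, hv⟩ hab
      refine Or.inr ⟨?_, hvb⟩
      exact ((hB b a y hvb hab.2.1 ha.1 hab.1.symm (Setoid.symm' _ ha.2)).1 hadj).symm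
    · have hyb : s y b := hF a y b ⟨ha.1.symm, hab.2.1, hy⟩ hab
      exact Or.inl ⟨(hB a y b ha.2 hy hadj ha.1.symm hyb).2 hab.1, hyb⟩
  · have hN : ∀ a, F.Adj v a → s y a → a ∈ D := fun a ha hya =>
      hD v a hvD ⟨ha, hv, fun h => hy (h.congr (Setoid.symm' _ hya))⟩
    intro a ha
    rw [mem_union, mem_nbrs, mem_nbrs] at ha
    rcases ha with ha | ha
    · exact hN a ha.1 ha.2
    · exact hD y a (hN y hadj (Setoid.refl' _ y))
        ⟨ha.1, hy, fun h => hv (h.congr (Setoid.symm' _ ha.2))⟩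

theorem adj_biclique_iff (hF : UniqueMates F s S) {v y : V} (hvy : OuterAdj F s S v y)
    (hB : InBiclique F s S v) {a b : V} (ha : a ∈ nbrs F v (s y) ∪ nbrs F y (s v))
    (hb : b ∈ nbrs F v (s y) ∪ nbrs F y (s v)) :
    F.Adj a b ↔ (a ∈ nbrs F v (s y) ↔ b ∈ nbrs F y (s v)) := by
  have hdisj := disjoint_left.1 (disjoint_biclique hvy hB)
  obtain ⟨hadj, hv, hy⟩ := hvy
  have key : ∀ c d, c ∈ nbrs F v (s y) → d ∈ nbrs F y (s v) → F.Adj c d := by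
    intro c d hc hd
    rw [mem_nbrs] at hc hd
    exact ((hB d y c hd.2 hy hadj hd.1.symm hc.2).1 hc.1).symm
  have hN : ∀ c d, c ∈ nbrs F v (s y) → d ∈ nbrs F v (s y) → ¬ F.Adj c d := by
    intro c d hc hd hcd
    rw [mem_nbrs] at hc hd
    have hc' : ¬ Inside s S c := fun h => hy (h.congr (Setoid.symm' _ hc.2))
    have hd' : ¬ Inside s S d := fun h => hy (h.congr (Setoid.symm' _ hd.2))
    have hvd : s v d := hF c v d ⟨hc.1.symm, hc', hv⟩ ⟨hcd, hc', hd'⟩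
    exact F.irrefl ((hB d c d hvd hc' hc.1 hcd.symm
      (Setoid.trans' _ (Setoid.symm' _ hc.2) hd.2)).1 hd.1)
  have hM : ∀ c d, c ∈ nbrs F y (s v) → d ∈ nbrs F y (s v) → ¬ F.Adj c d := by
    intro c d hc hd hcd
    have hd₂ := hd
    rw [mem_nbrs] at hc hd
    have hc' : ¬ Inside s S c := fun h => hv (h.congr (Setoid.symm' _ hc.2))
    have hd' : ¬ Inside s S d := fun h => hv (h.congr (Setoid.symm' _ hd.2))
    have hyd : s y d := hF c y d ⟨hc.1.symm, hc', hy⟩ ⟨hcd, hc', hd'⟩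
    have hvd : F.Adj v d := (hB c y d hc.2 hy hadj hc.1.symm hyd).2 hcd
    exact hdisj (mem_nbrs.2 ⟨hvd, hyd⟩) hd₂
  rw [mem_union] at ha hb
  rcases ha with ha | ha <;> rcases hb with hb | hb
  · exact iff_of_false (hN a b ha hb) fun h => hdisj hb (h.1 ha)
  · exact iff_of_true (key a b ha hb) (iff_of_true ha hb)
  · exact iff_of_true (key b a hb ha).symm
      (iff_of_false (fun h => hdisj h ha) fun h => hdisj hb h)
  · exact iff_of_false (hM a b ha hb) fun h => hdisj (h.2 hb) ha

/-- Being in a clique spreads along outer edges, so it is constant on components. -/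
theorem not_inClique_of_mem_biclique (hF : UniqueMates F s S) {v y : V}
    (hvy : OuterAdj F s S v y) (hK : ¬ InClique F s v) {a : V}
    (ha : a ∈ nbrs F v (s y) ∪ nbrs F y (s v)) : ¬ InClique F s a := by
  intro hKa
  obtain ⟨hadj, hv, hy⟩ := hvy
  have step : ∀ b c, ¬ Inside s S b → ¬ Inside s S c → F.Adj b c → InClique F s b →
      InClique F s c := by
    intro b c hb hc hbc hKb
    obtain ⟨d, hbd, hd⟩ := hKb.1
    have := hF b d c ⟨hd, hb, fun h => hb (h.congr (Setoid.symm' _ hbd))⟩ ⟨hbc, hb, hc⟩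
    exact hKb.of_adj (Setoid.trans' _ hbd this) hbc
  rw [mem_union, mem_nbrs, mem_nbrs] at ha
  rcases ha with ha | ha
  · exact hK (step a v (fun h => hy (h.congr (Setoid.symm' _ ha.2))) hv ha.1.symm hKa)
  · exact hK (step y v hy hv hadj.symm
      (step a y (fun h => hv (h.congr (Setoid.symm' _ ha.2))) hy ha.1.symm hKa))

end

/-! ### Matching the pieces of G and H. -/

section

/-- Two families of points, `x ↦ p` with `B x p` and `x ↦ p` with `B' x p`, with equally large
fibers differ by a permutation. -/
theorem exists_perm_of_point_maps {V : Type u} [Fintype V] {P D : Finset V}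
    {B B' : V → V → Prop} (hB : ∀ x ∈ D, #(P.filter (B x)) = 1)
    (hB' : ∀ x ∈ D, #(P.filter (B' x)) = 1)
    (hc : ∀ p ∈ P, #(D.filter fun x => B x p) = #(D.filter fun x => B' x p)) :
    ∃ π : Equiv.Perm V, (∀ x ∈ D, π x ∈ D) ∧ ∀ x ∈ D, ∀ p ∈ P, (B x p ↔ B' (π x) p) := by
  have hpt : ∀ {B : V → V → Prop}, (∀ x ∈ D, #(P.filter (B x)) = 1) →
      ∀ x, ∃ p, x ∈ D → p ∈ P ∧ ∀ q ∈ P, (B x q ↔ p = q) := by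
    intro B hB x
    by_cases hx : x ∈ D
    swap
    · exact ⟨x, fun h => absurd h hx⟩
    obtain ⟨p, hp⟩ := card_eq_one.1 (hB x hx)
    have hmem : ∀ q, q ∈ P ∧ B x q ↔ q = p := by
      intro q
      rw [← mem_filter, hp, mem_singleton]
    refine ⟨p, fun _ => ⟨((hmem p).2 rfl).1, fun q hq => ?_⟩⟩
    rw [eq_comm, ← hmem, and_iff_right hq]
  choose f hf using hpt hB
  choose f' hf' using hpt hB'
  -- Points outside D get the value `none`, which forces the permutation to preserve D.
  obtain ⟨π, hπ⟩ := exists_equiv_of_card_fiber_eq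
    (f := fun x => if x ∈ D then some (f x) else none)
    (g := fun x => if x ∈ D then some (f' x) else none) (by
      intro q
      rcases q with _ | p
      · congr 1
        ext x
        by_cases hx : x ∈ D <;> simp [hx]
      · by_cases hp : p ∈ P
        · have h1 : ∀ {B : V → V → Prop} {f : V → V},
              (∀ x, x ∈ D → f x ∈ P ∧ ∀ q ∈ P, (B x q ↔ f x = q)) →
              (univ.filter fun x => (if x ∈ D then some (f x) else none) = some p) =
                D.filter fun x => B x p := by
            intro B f hf
            ext x
            by_cases hx : x ∈ D
            · simp [hx, (hf x hx).2 p hp]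
            · simp [hx]
          convert (congrArg card (h1 hf)).trans
            ((hc p hp).trans (congrArg card (h1 hf')).symm)
        · have h1 : ∀ {B : V → V → Prop} {f : V → V},
              (∀ x, x ∈ D → f x ∈ P ∧ ∀ q ∈ P, (B x q ↔ f x = q)) →
              (univ.filter fun x => (if x ∈ D then some (f x) else none) = some p) = ∅ := by
            intro B f hf
            ext x
            by_cases hx : x ∈ D
            · have : f x ≠ p := fun h => hp (h ▸ (hf x hx).1)
              simp [hx, this]
            · simp [hx]
          convert (congrArg card (h1 hf)).trans (congrArg card (h1 hf')).symm)
  have key : ∀ x ∈ D, π x ∈ D ∧ f' (π x) = f x := by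
    intro x hx
    have := hπ x
    by_cases hx' : π x ∈ D
    · simp only [hx, hx', if_true, Option.some.injEq] at this
      exact ⟨hx', this⟩
    · simp [hx, hx'] at this
  refine ⟨π, fun x hx => (key x hx).1, fun x hx p hp => ?_⟩
  rw [(hf x hx).2 p hp, (hf' _ (key x hx).1).2 p hp, (key x hx).2]

variable {V : Type u} [Fintype V] {C : Type w} {G H : SimpleGraph V} {χ : V → C}
  {S T : Finset V}

/-- An all-or-nothing neighborhood is determined by its size. -/
theorem adj_iff_of_trivial {x y : V} {B : V → Prop} (hc : #(nbrs G x B) = #(nbrs H y B))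
    (ht : ∀ a b, B a → B b → G.Adj x a → G.Adj x b) {z : V} (hz : B z) :
    G.Adj x z ↔ H.Adj y z := by
  by_cases hx : G.Adj x z
  · refine iff_of_true hx ?_
    have h1 : nbrs G x B = univ.filter B := by
      ext a
      simp only [mem_nbrs, mem_filter, mem_univ, true_and, and_iff_right_iff_imp]
      exact fun ha => ht z a hz ha hx
    have h2 : nbrs H y B = univ.filter B := by
      refine eq_of_subset_of_card_le (fun a ha => ?_) (by rw [← hc, h1])
      exact mem_filter.2 ⟨mem_univ a, (mem_nbrs.1 ha).2⟩
    have : z ∈ nbrs H y B := by simpa [h2] using hz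
    exact (mem_nbrs.1 this).1
  · refine iff_of_false hx fun hy => ?_
    have h1 : nbrs G x B = ∅ := by
      rw [eq_empty_iff_forall_notMem]
      intro a ha
      rw [mem_nbrs] at ha
      exact hx (ht a z ha.2 hz ha.1)
    rw [h1, card_empty, eq_comm, card_eq_zero] at hc
    exact notMem_empty z (hc ▸ mem_nbrs.2 ⟨hy, hz⟩)

theorem Stuck.uniqueMates (h : Stuck G χ S T) : UniqueMates G (refinement G χ T) S :=
  fun _ _ _ hy hz => h.mate_unique hy.2.1 hy.2.2 hz.2.2 hy.1 hz.1

theorem card_nbrs_transfer (ht : PairTransfer (refinement G χ T) G H) {v w : V}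
    (hvw : refinement G χ T v w) {B : V → Prop} (hB : Saturated (refinement G χ T) B) :
    #(nbrs G v B) = #(nbrs H w B) :=
  (card_nbrs_eq hB hvw).trans (ht.card_nbrs_eq w hB)

/-- A component is a single vertex, a clique or a biclique, and its sizes are degrees into classes,
which agree in G and H. The type is part of the color because color refinement need not see it: a
triangle and a 4-cycle are both 2-regular. -/
theorem Stuck.componentsMatch (h : Stuck G χ S T) (ht : PairTransfer (refinement G χ T) G H)
    {v w : V} (hvw : refinement G χ T v w)
    (hK : InClique G (refinement G χ T) v ↔ InClique G (refinement G χ T) w) :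
    ComponentsMatch (OuterAdj G (refinement G χ T) S) (OuterAdj H (refinement G χ T) S)
      (fun a => (Quotient.mk (refinement G χ T) a, InClique G (refinement G χ T) a)) v w := by
  set s := refinement G χ T with hs
  have hG : UniqueMates G s S := h.uniqueMates
  have hH : UniqueMates H s S := ht.uniqueMates hG
  have hKH : ∀ a, InClique G s a ↔ InClique H s a :=
    fun a => ⟨ht.inClique, ht.symm.inClique⟩
  by_cases hex : ∃ y, OuterAdj G s S v y
  swap
  · push Not at hex
    refine ⟨{v}, {w}, fun _ => w, isComponent_singleton hex, isComponent_singleton ?_, ?_, ?_, ?_⟩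
    · intro y hy
      obtain ⟨z, hyz, hwz⟩ := ht.exists_adj hy.1
      obtain ⟨z', hvz', hz'⟩ := exists_adj_of_refinement (saturated_self z)
        (Setoid.symm' _ hvw) hwz (Setoid.refl' _ z)
      exact hex z' ⟨hvz', fun h => hy.2.1 (h.congr hvw), fun h => hy.2.2
        (h.congr (Setoid.symm' _ (Setoid.trans' _ hyz hz')))⟩
    · simp
    · intro a ha
      rw [mem_singleton] at ha
      subst ha
      exact Prod.ext (Quotient.sound (Setoid.symm' _ hvw)) (propext hK.symm)
    · intro a ha b hb
      rw [mem_singleton] at ha hb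
      subst ha hb
      exact iff_of_false (fun h => G.irrefl h.1) fun h => H.irrefl h.1
  obtain ⟨y, hvy⟩ := hex
  have hw : ¬ Inside s S w := fun h => hvy.2.1 (h.congr (Setoid.symm' _ hvw))
  have hsat : ∀ a, Saturated s (s a) := fun a => saturated_self a
  by_cases hKv : InClique G s v
  · have hKw : InClique H s w := (hKH w).1 (hK.1 hKv)
    have hcard : #(insert v (nbrs G v (s v))) = #(insert w (nbrs H w (s w))) := by
      have h1 : nbrs H w (s w) = nbrs H w (s v) := by
        ext z
        rw [mem_nbrs, mem_nbrs]
        exact and_congr_right fun _ => ⟨fun h => Setoid.trans' _ hvw h,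
          fun h => Setoid.trans' _ (Setoid.symm' _ hvw) h⟩
      rw [card_insert_of_notMem (by simp), card_insert_of_notMem (by simp), h1,
        card_nbrs_transfer ht hvw (hsat v)]
    obtain ⟨φ, hφ⟩ := exists_bijOn_of_card_eq hcard
    refine ⟨_, _, φ, isComponent_clique hG hvy.2.1 hKv, isComponent_clique hH hw hKw, hφ, ?_, ?_⟩
    · have key : ∀ {F : SimpleGraph V} {x a : V}, InClique F s x →
          a ∈ insert x (nbrs F x (s x)) → s x a ∧ InClique F s a := by
        intro F x a hx ha
        rw [mem_insert, mem_nbrs] at ha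
        rcases ha with rfl | ha
        · exact ⟨Setoid.refl' _ _, hx⟩
        · exact ⟨ha.2, hx.of_adj ha.2 ha.1⟩
      intro a ha
      obtain ⟨h1, h2⟩ := key hKv ha
      obtain ⟨h3, h4⟩ := key hKw (hφ.mapsTo ha)
      refine Prod.ext (Quotient.sound ?_) (propext (iff_of_true ((hKH _).2 h4) h2))
      exact Setoid.trans' _ (Setoid.symm' _ h3) (Setoid.trans' _ (Setoid.symm' _ hvw) h1)
    · have key : ∀ {F : SimpleGraph V} {x a : V}, ¬ Inside s S x →
          a ∈ insert x (nbrs F x (s x)) → ¬ Inside s S a := by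
        intro F x a hx ha
        rw [mem_insert, mem_nbrs] at ha
        rcases ha with rfl | ha
        · exact hx
        · exact fun h => hx (h.congr (Setoid.symm' _ ha.2))
      intro a ha b hb
      have ha' := hφ.mapsTo ha
      have hb' := hφ.mapsTo hb
      rw [OuterAdj, OuterAdj, adj_iff_ne_of_inClique hKv ha hb,
        adj_iff_ne_of_inClique hKw ha' hb', hφ.injOn.ne_iff ha hb]
      exact and_congr_right fun _ => iff_of_true ⟨key hvy.2.1 ha, key hvy.2.1 hb⟩
        ⟨key hw ha', key hw hb'⟩
  · have hBv : InBiclique G s S v := (h.inBiclique_or_inClique hvy.2.1).resolve_right hKv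
    have hKw : ¬ InClique G s w := fun h => hKv (hK.2 h)
    have hBw : InBiclique H s S w := ht.inBiclique ((h.inBiclique_or_inClique hw).resolve_right hKw)
    have hN : #(nbrs G v (s y)) = #(nbrs H w (s y)) := card_nbrs_transfer ht hvw (hsat y)
    obtain ⟨y', hy'⟩ : (nbrs H w (s y)).Nonempty := by
      rw [← card_pos, ← hN]
      exact card_pos.2 ⟨y, mem_nbrs.2 ⟨hvy.1, Setoid.refl' _ y⟩⟩
    rw [mem_nbrs] at hy'
    have hwy' : OuterAdj H s S w y' :=
      ⟨hy'.1, hw, fun h => hvy.2.2 (h.congr (Setoid.symm' _ hy'.2))⟩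
    have hNeq : nbrs H w (s y') = nbrs H w (s y) := by
      ext z
      rw [mem_nbrs, mem_nbrs]
      exact and_congr_right fun _ => ⟨fun h => Setoid.trans' _ hy'.2 h,
        fun h => Setoid.trans' _ (Setoid.symm' _ hy'.2) h⟩
    have hMeq : nbrs H y' (s w) = nbrs H y' (s v) := by
      ext z
      rw [mem_nbrs, mem_nbrs]
      exact and_congr_right fun _ => ⟨fun h => Setoid.trans' _ hvw h,
        fun h => Setoid.trans' _ (Setoid.symm' _ hvw) h⟩
    have hM : #(nbrs G y (s v)) = #(nbrs H y' (s w)) := by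
      rw [hMeq]
      exact card_nbrs_transfer ht hy'.2 (hsat v)
    rw [← hNeq] at hN
    obtain ⟨φ₁, hφ₁⟩ := exists_bijOn_of_card_eq hN
    obtain ⟨φ₂, hφ₂⟩ := exists_bijOn_of_card_eq hM
    have hd := disjoint_left.1 (disjoint_biclique hvy hBv)
    have hd' := disjoint_left.1 (disjoint_biclique hwy' hBw)
    set φ : V → V := fun a => if a ∈ nbrs G v (s y) then φ₁ a else φ₂ a with hφ
    have e1 : ∀ a ∈ nbrs G v (s y), φ a = φ₁ a := fun a ha => if_pos ha
    have e2 : ∀ a ∈ nbrs G y (s v), φ a = φ₂ a := fun a ha => if_neg fun h => hd h ha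
    have m1 : ∀ a ∈ nbrs G v (s y), φ a ∈ nbrs H w (s y') := fun a ha => by
      rw [e1 a ha]
      exact hφ₁.mapsTo ha
    have m2 : ∀ a ∈ nbrs G y (s v), φ a ∈ nbrs H y' (s w) := fun a ha => by
      rw [e2 a ha]
      exact hφ₂.mapsTo ha
    have hbij : Set.BijOn φ (nbrs G v (s y) ∪ nbrs G y (s v) : Finset V)
        (nbrs H w (s y') ∪ nbrs H y' (s w) : Finset V) := by
      rw [coe_union, coe_union]
      refine Set.BijOn.union (hφ₁.congr fun a ha => (e1 a ha).symm)
        (hφ₂.congr fun a ha => (e2 a ha).symm) ?_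
      intro a ha b hb hab
      rcases ha with ha | ha <;> rcases hb with hb | hb
      · rw [e1 a ha, e1 b hb] at hab
        exact hφ₁.injOn ha hb hab
      · exact absurd (hab ▸ m1 a ha) fun h => hd' h (m2 b hb)
      · exact absurd (hab ▸ m2 a ha) fun h => hd' (m1 b hb) h
      · rw [e2 a ha, e2 b hb] at hab
        exact hφ₂.injOn ha hb hab
    have hcls : ∀ a ∈ nbrs G v (s y) ∪ nbrs G y (s v), s (φ a) a := by
      intro a ha
      rcases mem_union.1 ha with ha | ha
      · exact Setoid.trans' _ (Setoid.symm' _ (mem_nbrs.1 (m1 a ha)).2)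
          (Setoid.trans' _ (Setoid.symm' _ hy'.2) (mem_nbrs.1 ha).2)
      · exact Setoid.trans' _ (Setoid.symm' _ (mem_nbrs.1 (m2 a ha)).2)
          (Setoid.trans' _ (Setoid.symm' _ hvw) (mem_nbrs.1 ha).2)
    have hout : ∀ a ∈ nbrs G v (s y) ∪ nbrs G y (s v), ¬ Inside s S a := by
      intro a ha hin
      rcases mem_union.1 ha with ha | ha
      · exact hvy.2.2 (hin.congr (Setoid.symm' _ (mem_nbrs.1 ha).2))
      · exact hvy.2.1 (hin.congr (Setoid.symm' _ (mem_nbrs.1 ha).2))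
    refine ⟨_, _, φ, isComponent_biclique hG hvy hBv, isComponent_biclique hH hwy' hBw, hbij,
      ?_, ?_⟩
    · intro a ha
      refine Prod.ext (Quotient.sound (hcls a ha)) (propext (iff_of_false ?_ ?_))
      · change ¬ InClique G s (φ a)
        rw [hKH]
        exact not_inClique_of_mem_biclique hH hwy' (fun h => hKw ((hKH w).2 h)) (hbij.mapsTo ha)
      · exact not_inClique_of_mem_biclique hG hvy hKv ha
    · intro a ha b hb
      have ha' := hbij.mapsTo ha
      have hb' := hbij.mapsTo hb
      have i1 : a ∈ nbrs G v (s y) ↔ φ a ∈ nbrs H w (s y') := by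
        refine ⟨m1 a, fun h => ?_⟩
        by_contra hcon
        exact hd' h (m2 a ((mem_union.1 ha).resolve_left hcon))
      have i2 : b ∈ nbrs G y (s v) ↔ φ b ∈ nbrs H y' (s w) := by
        refine ⟨m2 b, fun h => ?_⟩
        by_contra hcon
        exact hd' (m1 b ((mem_union.1 hb).resolve_right hcon)) h
      rw [OuterAdj, OuterAdj, adj_biclique_iff hG hvy hBv ha hb,
        adj_biclique_iff hH hwy' hBw ha' hb', i1, i2]
      exact and_congr_right fun _ => iff_of_true ⟨hout a ha, hout b hb⟩
        ⟨fun h => hout a ha (h.congr (hcls a ha)), fun h => hout b hb (h.congr (hcls b hb))⟩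

end

/-! ### Assembling the isomorphism. -/

section

variable {V : Type u} [Fintype V] {C : Type w} {G H : SimpleGraph V} {χ : V → C}
  {S T : Finset V}

theorem filter_class_filter_adj (F : SimpleGraph V) (s : Setoid V) (p x : V) :
    (univ.filter (s p)).filter (F.Adj x) = nbrs F x (s p) := by
  ext z
  simp [and_comm]

theorem filter_class_filter_adj_right (F : SimpleGraph V) (s : Setoid V) (a p : V) :
    ((univ.filter (s a)).filter fun x => F.Adj x p) = nbrs F p (s a) := by
  ext z
  simp [and_comm, F.adj_comm]

/-- The vertices of a class not contained in `S` can be permuted such that their neighborhoods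
in the classes contained in `S` are the same in `G` and `H`. -/
theorem Stuck.exists_perm_class (h : Stuck G χ S T) (ht : PairTransfer (refinement G χ T) G H)
    (a : V) : ∃ π : Equiv.Perm V,
      (∀ x, refinement G χ T a x → refinement G χ T a (π x)) ∧
      ∀ x, refinement G χ T a x → ∀ p, Inside (refinement G χ T) S p →
        (G.Adj x p ↔ H.Adj (π x) p) := by
  set s := refinement G χ T with hs
  have hsat : ∀ a, Saturated s (s a) := fun a => saturated_self a
  -- If no class inside S is split, the identity works. Otherwise, degrees being constant, every
  -- vertex of the class of a splits the same class P, hence no other one.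
  by_cases hex : ∃ p x y z, Inside s S p ∧ s a x ∧ s p y ∧ s p z ∧ G.Adj x y ∧ ¬ G.Adj x z
  swap
  · push Not at hex
    refine ⟨Equiv.refl V, fun x hx => hx, fun x hx p hp => ?_⟩
    exact adj_iff_of_trivial (ht.card_nbrs_eq x (hsat p))
      (fun y z hy hz hxy => hex p x y z hp hx hy hz hxy) (Setoid.refl' _ p)
  obtain ⟨p₀, x₀, y₀, z₀, hp₀, hx₀, hy₀, hz₀, hxy₀, hxz₀⟩ := hex
  set P := univ.filter (s p₀) with hP
  set D := univ.filter (s a) with hD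
  have memP : ∀ z, z ∈ P ↔ s p₀ z := by simp [hP]
  have memD : ∀ z, z ∈ D ↔ s a z := by simp [hD]
  have hdegG : ∀ x ∈ D, #(P.filter (G.Adj x)) = #(P.filter (G.Adj x₀)) := by
    intro x hx
    rw [hP, filter_class_filter_adj, filter_class_filter_adj]
    exact card_nbrs_eq (hsat p₀) (Setoid.trans' _ (Setoid.symm' _ ((memD x).1 hx)) hx₀)
  have hdegH : ∀ x ∈ D, #(P.filter (H.Adj x)) = #(P.filter (G.Adj x₀)) := by
    intro x hx
    rw [← hdegG x hx, hP, filter_class_filter_adj, filter_class_filter_adj]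
    exact (ht.card_nbrs_eq x (hsat p₀)).symm
  have hfib : ∀ p, #(D.filter fun x => G.Adj x p) = #(D.filter fun x => H.Adj x p) := by
    intro p
    rw [hD, filter_class_filter_adj_right, filter_class_filter_adj_right]
    exact ht.card_nbrs_eq p (hsat a)
  have hcompl : ∀ (X : Finset V) (p : V → Prop),
      #(X.filter p) + #(X.filter fun z => ¬ p z) = #X :=
    fun X p => card_filter_add_card_filter_not _
  have hpos : 0 < #(P.filter (G.Adj x₀)) :=
    card_pos.2 ⟨y₀, mem_filter.2 ⟨(memP y₀).2 hy₀, hxy₀⟩⟩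
  have hpos' : 0 < #(P.filter fun z => ¬ G.Adj x₀ z) :=
    card_pos.2 ⟨z₀, mem_filter.2 ⟨(memP z₀).2 hz₀, hxz₀⟩⟩
  obtain ⟨π, hπD, hπ⟩ : ∃ π : Equiv.Perm V, (∀ x ∈ D, π x ∈ D) ∧
      ∀ x ∈ D, ∀ p ∈ P, (G.Adj x p ↔ H.Adj (π x) p) := by
    -- Each block in P, or its complement, is a single point. How often a point occurs is read off
    -- from its degree into D, which is the same in G and H.
    rcases h.card_block hp₀ x₀ with hle | hle
    · have h1 : #(P.filter (G.Adj x₀)) = 1 := le_antisymm hle hpos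
      refine exists_perm_of_point_maps (fun x hx => ?_) (fun x hx => ?_) fun p _ => hfib p
      · rw [hdegG x hx, h1]
      · rw [hdegH x hx, h1]
    · have h1 : #(P.filter fun z => ¬ G.Adj x₀ z) = 1 := le_antisymm hle hpos'
      obtain ⟨π, hπD, hπ⟩ := exists_perm_of_point_maps (P := P) (D := D)
        (B := fun x p => ¬ G.Adj x p) (B' := fun x p => ¬ H.Adj x p)
        (fun x hx => by
          have e1 := hcompl P (G.Adj x)
          have e2 := hcompl P (G.Adj x₀)
          have e3 := hdegG x hx
          have e4 : #(P.filter fun z => ¬ G.Adj x z) = 1 := by omega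
          convert e4)
        (fun x hx => by
          have e1 := hcompl P (H.Adj x)
          have e2 := hcompl P (G.Adj x₀)
          have e3 := hdegH x hx
          have e4 : #(P.filter fun z => ¬ H.Adj x z) = 1 := by omega
          convert e4)
        (fun p _ => by
          have e1 := hcompl D fun x => G.Adj x p
          have e2 := hcompl D fun x => H.Adj x p
          have e3 := hfib p
          have e4 : #(D.filter fun x => ¬ G.Adj x p) = #(D.filter fun x => ¬ H.Adj x p) := by
            omega
          convert e4)
      exact ⟨π, hπD, fun x hx p hp => not_iff_not.1 (hπ x hx p hp)⟩
  refine ⟨π, fun x hx => (memD _).1 (hπD x ((memD x).2 hx)), fun x hx p hp => ?_⟩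
  by_cases hp' : s p₀ p
  · exact hπ x ((memD x).2 hx) p ((memP p).2 hp')
  · have hxx : s x (π x) := Setoid.trans' _ (Setoid.symm' _ hx)
      ((memD _).1 (hπD x ((memD x).2 hx)))
    refine adj_iff_of_trivial (card_nbrs_transfer ht hxx (hsat p)) (fun y z hy hz hxy => ?_)
      (Setoid.refl' _ p)
    by_contra hxz
    have hxD := (memD x).2 hx
    obtain ⟨y₁, hy₁⟩ := card_pos.1 (hpos.trans_eq (hdegG x hxD).symm)
    obtain ⟨z₁, hz₁⟩ : (P.filter fun z => ¬ G.Adj x z).Nonempty := by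
      rw [← card_pos]
      have e1 := hcompl P (G.Adj x)
      have e2 := hcompl P (G.Adj x₀)
      have e3 := hdegG x hxD
      omega
    rw [mem_filter, memP] at hy₁ hz₁
    exact h.not_split_two hp₀ hp hp' hy₁.1 hz₁.1 hy hz hy₁.2 hz₁.2 hxy hxz

theorem Stuck.adj_iff_of_inside (h : Stuck G χ S T) (ht : PairTransfer (refinement G χ T) G H)
    {u v : V} (hu : Inside (refinement G χ T) S u) (hv : Inside (refinement G χ T) S v) :
    G.Adj u v ↔ H.Adj u v := by
  by_cases huv : refinement G χ T u v
  · by_cases hne : v = u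
    · subst hne
      exact iff_of_false (G.irrefl) (H.irrefl)
    have hc := ht.card_nbrs_eq u (saturated_self (G := G) (χ := χ) (T := T) u)
    -- Removing u from its class does not change its neighbors there and leaves a set to which u is
    -- joined all-or-nothing.
    have key : ∀ F : SimpleGraph V,
        nbrs F u (refinement G χ T u) = nbrs F u fun z => refinement G χ T u z ∧ z ≠ u := by
      intro F
      ext z
      rw [mem_nbrs, mem_nbrs]
      exact and_congr_right fun hz => (and_iff_left hz.ne').symm
    rw [key, key] at hc
    exact adj_iff_of_trivial hc
      (fun a b ha hb => (h.adj_same_class_iff hu ha.1 hb.1 ha.2 hb.2).1) ⟨huv, hne⟩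
  · exact adj_iff_of_trivial (ht.card_nbrs_eq u (saturated_self v))
      (fun a b ha hb => h.adj_inside_iff hu hv huv ha hb) (Setoid.refl' _ v)

theorem Stuck.exists_iso (h : Stuck G χ S T) (ht : PairTransfer (refinement G χ T) G H) :
    ∃ φ : G ≃g H, ∀ v, refinement G χ T v (φ v) := by
  set s := refinement G χ T with hs
  have hsat : ∀ a, Saturated s (s a) := fun a => saturated_self a
  obtain ⟨μ, hμc, hμ⟩ := exists_perm_of_componentsMatch
    (r := OuterAdj G s S) (r' := OuterAdj H s S)
    (c := fun a => (Quotient.mk s a, InClique G s a))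
    (fun _ _ => OuterAdj.symm) (fun _ _ => OuterAdj.symm) fun v w hc =>
      h.componentsMatch ht (Quotient.exact (congrArg Prod.fst hc))
        (iff_of_eq (congrArg Prod.snd hc))
  have hμs : ∀ v, s v (μ v) := fun v =>
    Setoid.symm' _ (Quotient.exact (congrArg Prod.fst (hμc v)))
  choose ρ hρs hρ using fun q : Quotient s => h.exists_perm_class ht q.out
  have hout : ∀ v, s (Quotient.mk s v).out v := fun v => Quotient.exact (Quotient.out_eq _)
  have hρs' : ∀ v, s v (ρ (Quotient.mk s v) v) := fun v =>
    Setoid.trans' _ (Setoid.symm' _ (hout v)) (hρs _ v (hout v))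
  -- The pieces do not interfere: mixed classes are joined all-or-nothing to classes inside S, and
  -- the remaining classes have edges only to classes inside S.
  set f : V → V := fun v => if Inside s S v then v else if Mixed s S v then μ v else
    ρ (Quotient.mk s v) v with hf
  have f1 : ∀ v, Inside s S v → f v = v := fun v hv => if_pos hv
  have f2 : ∀ v, ¬ Inside s S v → Mixed s S v → f v = μ v := fun v hv hv' => by
    rw [hf]
    simp only [if_neg hv, if_pos hv']
  have f3 : ∀ v, ¬ Inside s S v → ¬ Mixed s S v → f v = ρ (Quotient.mk s v) v :=
    fun v hv hv' => by
      rw [hf]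
      simp only [if_neg hv, if_neg hv']
  have hfs : ∀ v, s v (f v) := by
    intro v
    by_cases hv : Inside s S v
    · rw [f1 v hv]
    · by_cases hv' : Mixed s S v
      · rw [f2 v hv hv']
        exact hμs v
      · rw [f3 v hv hv']
        exact hρs' v
  have hinj : Function.Injective f := by
    intro v w hvw
    have hs' : s v w := Setoid.trans' _ (hfs v) (hvw ▸ Setoid.symm' _ (hfs w))
    by_cases hv : Inside s S v
    · rwa [f1 v hv, f1 w (hv.congr hs')] at hvw
    · have hw : ¬ Inside s S w := fun hw => hv (hw.congr (Setoid.symm' _ hs'))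
      by_cases hv' : Mixed s S v
      · rw [f2 v hv hv', f2 w hw (hv'.congr hs')] at hvw
        exact μ.injective hvw
      · have hw' : ¬ Mixed s S w := fun hw => hv' (hw.congr (Setoid.symm' _ hs'))
        rw [f3 v hv hv', f3 w hw hw', (Quotient.sound hs' : Quotient.mk s v = Quotient.mk s w)]
          at hvw
        exact (ρ _).injective hvw
  have hIn : ∀ u v, ¬ Inside s S u → Inside s S v → (G.Adj u v ↔ H.Adj (f u) (f v)) := by
    intro u v hu hv
    rw [f1 v hv]
    by_cases hu' : Mixed s S u
    · obtain ⟨y, huy, hy⟩ := h.exists_mate hu'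
      exact adj_iff_of_trivial (card_nbrs_transfer ht (hfs u) (hsat v))
        (fun a b ha hb => h.adj_inside_of_mixed hu hy.not_inside huy hv ha hb) (Setoid.refl' _ v)
    · rw [f3 u hu hu']
      exact hρ _ u (hout u) v hv
  have hnot : ∀ u v, ¬ Inside s S u → ¬ Inside s S v → ¬ Mixed s S v →
      ¬ G.Adj u v ∧ ¬ H.Adj u v := by
    intro u v hu hv hv'
    refine ⟨fun huv => hv' (h.mixed_of_adj hu hv huv), fun huv => ?_⟩
    obtain ⟨y, hvy, huy⟩ := ht.exists_adj huv
    exact hv' ((h.mixed_of_adj hu (fun hy => hv (hy.congr (Setoid.symm' _ hvy))) huy).congr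
      (Setoid.symm' _ hvy))
  have hadj : ∀ u v, G.Adj u v ↔ H.Adj (f u) (f v) := by
    intro u v
    have hfi : ∀ u, ¬ Inside s S u → ¬ Inside s S (f u) :=
      fun u hu h => hu (h.congr (Setoid.symm' _ (hfs u)))
    have hfm : ∀ u, ¬ Mixed s S u → ¬ Mixed s S (f u) :=
      fun u hu h => hu (h.congr (Setoid.symm' _ (hfs u)))
    by_cases hu : Inside s S u
    · by_cases hv : Inside s S v
      · rw [f1 u hu, f1 v hv]
        exact h.adj_iff_of_inside ht hu hv
      · rw [G.adj_comm, H.adj_comm]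
        exact hIn v u hv hu
    · by_cases hv : Inside s S v
      · exact hIn u v hu hv
      · by_cases hv' : Mixed s S v
        swap
        · exact iff_of_false (hnot u v hu hv hv').1
            (hnot _ _ (hfi u hu) (hfi v hv) (hfm v hv')).2
        by_cases hu' : Mixed s S u
        swap
        · rw [G.adj_comm, H.adj_comm]
          exact iff_of_false (hnot v u hv hu hu').1
            (hnot _ _ (hfi v hv) (hfi u hu) (hfm u hu')).2
        have hμ' := hμ u v
        rw [← f2 u hu hu', ← f2 v hv hv'] at hμ'
        exact ⟨fun h => (hμ'.1 ⟨h, hu, hv⟩).1, fun h => (hμ'.2 ⟨h, hfi u hu, hfi v hv⟩).1⟩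
  exact ⟨⟨Equiv.ofBijective f (Finite.injective_iff_bijective.1 hinj),
    fun {a b} => (hadj a b).symm⟩, hfs⟩

end

/-! ### From k-WL to pebble games, and the choice of T. -/

section

theorem exists_equiv_of_map_eq {V : Type u} {W : Type v} {K : Type w} [Fintype V] [Fintype W]
    {f : V → K} {g : W → K}
    (h : (univ : Finset V).val.map f = (univ : Finset W).val.map g) :
    ∃ π : V ≃ W, ∀ v, g (π v) = f v := by
  refine exists_equiv_of_card_fiber_eq fun q => ?_
  have h1 := congrArg (Multiset.count q) h
  rw [Multiset.count_map, Multiset.count_map] at h1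
  simp only [eq_comm (a := q)] at h1
  exact h1

variable {V : Type u} {W : Type v} {C : Type w}

/-- An invariant of the bijective game in which, for a bijection `f` of Duplicator, Spoiler may
replace any entry `j` of the tuples by a vertex and its image. -/
def IsTupleBisim {k : ℕ} (G : SimpleGraph V) (χ : V → C) (H : SimpleGraph W) (ψ : W → C)
    (E : (Fin k → V) → (Fin k → W) → Prop) : Prop :=
  ∀ x y, E x y → atomicType G χ x = atomicType H ψ y ∧
    ∃ f : V ≃ W, ∀ z j, E (Function.update x j z) (Function.update y j (f z))

theorem exists_isTupleBisim [Fintype V] [Nonempty V] [Fintype W] {k : ℕ} (hk : k ≠ 1)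
    {G : SimpleGraph V} {χ : V → C} {H : SimpleGraph W} {ψ : W → C}
    (h : ¬ Distinguishes k G χ H ψ) :
    ∃ E : (Fin k → V) → (Fin k → W) → Prop, IsTupleBisim G χ H ψ E ∧ ∀ x, ∃ y, E x y := by
  rw [Distinguishes, not_not] at h
  have hVW : ∀ x, ∃ y, wl k H ψ y = wl k G χ x := by
    intro x
    have : wl k G χ x ∈ (univ : Finset (Fin k → W)).val.map (wl k H ψ) := by
      rw [← h]
      exact Multiset.mem_map_of_mem _ (mem_univ x)
    obtain ⟨y, -, hy⟩ := Multiset.mem_map.1 this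
    exact ⟨y, hy⟩
  have hWV : ∀ y, ∃ x, wl k G χ x = wl k H ψ y := by
    intro y
    have : wl k H ψ y ∈ (univ : Finset (Fin k → V)).val.map (wl k G χ) := by
      rw [h]
      exact Multiset.mem_map_of_mem _ (mem_univ y)
    obtain ⟨x, -, hx⟩ := Multiset.mem_map.1 this
    exact ⟨x, hx⟩
  obtain ⟨v⟩ := ‹Nonempty V›
  -- Output colors carry their round, so one common color forces equal stabilization rounds.
  have hm : stableRound k H ψ = stableRound k G χ := by
    obtain ⟨y, hy⟩ := hVW fun _ => v
    have := congrArg Sigma.fst hy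
    exact Nat.succ.inj this
  have hstable : stableRound k G χ ∈ stableRounds k G χ :=
    Nat.sInf_mem (stableRounds_nonempty k G χ)
  unfold wl at hVW hWV
  rw [hm] at hVW hWV
  generalize stableRound k G χ = m at hVW hWV hstable
  -- The color of y in round m + 1 also occurs in G, at some x'; stability in G then lifts the
  -- equality from x to x'.
  have hup : ∀ x y, wlRound k G χ m x = wlRound k H ψ m y →
      wlRound k G χ (m + 1) x = wlRound k H ψ (m + 1) y := by
    intro x y hxy
    obtain ⟨x', hx'⟩ := hWV y
    have h1 : wlRound k G χ (m + 1) x' = wlRound k H ψ (m + 1) y :=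
      eq_of_heq (Sigma.mk.inj hx').2
    have h2 : wlRound k G χ m x' = wlRound k H ψ m y := congrArg Prod.fst h1
    rw [← h1]
    exact hstable.1 _ _ (hxy.trans h2.symm)
  refine ⟨fun x y => wlRound k G χ m x = wlRound k H ψ m y, fun x y hxy => ⟨?_, ?_⟩, fun x => ?_⟩
  · have : ∀ i, wlRound k G χ i x = wlRound k H ψ i y →
        atomicType G χ x = atomicType H ψ y := by
      intro i
      induction i with
      | zero => exact id
      | succ i ih => exact fun h => ih (congrArg Prod.fst h)
    exact this m hxy
  · have h1 := congrArg Prod.snd (hup x y hxy)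
    simp only [wlRound, hk, false_imp_iff, filter_true] at h1
    obtain ⟨f, hf⟩ := exists_equiv_of_map_eq h1
    exact ⟨f, fun z j => (congrFun (hf z) j).symm⟩
  · obtain ⟨y, hy⟩ := hVW x
    have h1 : wlRound k H ψ (m + 1) y = wlRound k G χ (m + 1) x :=
      eq_of_heq (Sigma.mk.inj hy).2
    exact ⟨y, (congrArg Prod.fst h1).symm⟩

/-- If `k`-WL does not distinguish two graphs, then `k - 3` vertices can be individualized such
that the graphs agree in the bijective game with the remaining pebbles. -/
theorem exists_pairTransfer [Nonempty V] {k : ℕ} {G : SimpleGraph V} {χ : V → C}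
    {H : SimpleGraph W} {ψ : W → C} {E : (Fin k → V) → (Fin k → W) → Prop}
    (hE : IsTupleBisim G χ H ψ E) (hne : ∀ x, ∃ y, E x y) (T : Finset V) (hT : #T + 3 ≤ k) :
    ∃ f : V ≃ W, (∀ v, ψ (f v) = χ v) ∧ PairTransfer (refinement G χ T) G (H.comap f) := by
  obtain ⟨v₀⟩ := ‹Nonempty V›
  -- The first #T entries hold T and are never moved; the others start at an arbitrary vertex.
  set x₀ : Fin k → V := fun i => if h : i.val < #T then T.equivFin.symm ⟨i, h⟩ else v₀ with hx₀
  have hx₀T : ∀ t ∈ T, ∃ i : Fin k, i.val < #T ∧ x₀ i = t := by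
    intro t ht
    have hlt := (T.equivFin ⟨t, ht⟩).2
    refine ⟨⟨T.equivFin ⟨t, ht⟩, by omega⟩, hlt, ?_⟩
    simp [hx₀]
  obtain ⟨y₀, hy₀⟩ := hne x₀
  set Good : (Fin k → V) → (Fin k → W) → Prop := fun x y =>
    E x y ∧ ∀ i : Fin k, i.val < #T → x i = x₀ i ∧ y i = y₀ i with hGood
  have hupdate : ∀ x y, Good x y → ∃ f : V ≃ W, ∀ z (j : Fin k), #T ≤ j.val →
      Good (Function.update x j z) (Function.update y j (f z)) := by
    rintro x y ⟨hxy, hpin⟩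
    obtain ⟨-, f, hf⟩ := hE x y hxy
    refine ⟨f, fun z j hj => ⟨hf z j, fun i hi => ?_⟩⟩
    have hij : i ≠ j := by
      rintro rfl
      omega
    rw [Function.update_of_ne hij, Function.update_of_ne hij]
    exact hpin i hi
  have hcol : ∀ x y, Good x y → ∀ i, χ (x i) = ψ (y i) := fun x y h i =>
    congrFun (congrArg AtomicType.color (hE x y h.1).1) i
  have heq : ∀ x y, Good x y → ∀ i j, x i = x j ↔ y i = y j := fun x y h i j =>
    iff_of_eq (congrFun (congrFun (congrArg AtomicType.eq (hE x y h.1).1) i) j)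
  have hadj : ∀ x y, Good x y → ∀ i j, G.Adj (x i) (x j) ↔ H.Adj (y i) (y j) := fun x y h i j =>
    iff_of_eq (congrFun (congrFun (congrArg AtomicType.adj (hE x y h.1).1) i) j)
  set R : V → W → Prop := fun v w =>
    ∃ x y, Good x y ∧ ∃ j : Fin k, #T ≤ j.val ∧ x j = v ∧ y j = w with hR
  set κ : V → W → Prop := fun v w =>
    χ v = ψ w ∧ ∀ i : Fin k, i.val < #T → (v = x₀ i ↔ w = y₀ i) with hκ
  have hpair : ∀ (x : Fin k → V) (y : Fin k → W) (i j : Fin k) (z : V) (z' : W), i ≠ j →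
      Good (Function.update x j z) (Function.update y j z') →
      (z = x i ↔ z' = y i) ∧ (G.Adj (x i) z ↔ H.Adj (y i) z') := by
    intro x y i j z z' hij h
    have h1 := heq _ _ h j i
    have h2 := hadj _ _ h i j
    simp only [Function.update_self, Function.update_of_ne hij] at h1 h2
    exact ⟨h1, h2⟩
  have hbisim : IsBisim G H κ R := by
    rintro v w ⟨x, y, hxy, j, hj, rfl, rfl⟩
    refine ⟨⟨hcol x y hxy j, fun i hi => ?_⟩, ?_⟩
    · rw [← (hxy.2 i hi).1, ← (hxy.2 i hi).2]
      exact heq x y hxy j i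
    · obtain ⟨f, hf⟩ := hupdate x y hxy
      -- The new vertex z needs a free entry other than j, which still holds v.
      obtain ⟨l, hl, hjl⟩ : ∃ l : Fin k, #T ≤ l.val ∧ j ≠ l := by
        by_cases hj' : j.val = #T
        · exact ⟨⟨#T + 1, by omega⟩, by simp, fun h => by
            have := congrArg Fin.val h
            simp at this
            omega⟩
        · exact ⟨⟨#T, by omega⟩, le_rfl, fun h => hj' (congrArg Fin.val h)⟩
      refine ⟨f, fun z => ⟨⟨_, _, hf z l hl, l, hl, by simp, by simp⟩, ?_⟩⟩
      exact (hpair x y j l z (f z) hjl (hf z l hl)).2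
  -- Going to w and back composes to a bisimulation of G with itself; this converts matches with
  -- vertices of H into refinement classes.
  have hcomp : ∀ v v' w, R v w → R v' w → refinement G χ T v v' := by
    intro v v' w h h'
    refine Bisimilar.comp (κ := κ) (κ' := fun w v => κ v w) ?_ ⟨R, hbisim, h⟩
      (Bisimilar.swap (fun _ _ h => h) ⟨R, hbisim, h'⟩)
    rintro a b c ⟨h1, h2⟩ ⟨h3, h4⟩
    refine ⟨h1.trans h3.symm, fun t ht => ?_⟩
    obtain ⟨i, hi, rfl⟩ := hx₀T t ht
    exact (h2 i hi).trans (h4 i hi).symm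
  set j₁ : Fin k := ⟨#T, by omega⟩ with hj₁
  set j₂ : Fin k := ⟨#T + 1, by omega⟩ with hj₂
  set j₃ : Fin k := ⟨#T + 2, by omega⟩ with hj₃
  have l₁ : #T ≤ j₁.val := le_rfl
  have l₂ : #T ≤ j₂.val := by simp [hj₂]
  have l₃ : #T ≤ j₃.val := by simp [hj₃]
  have n₁₂ : j₁ ≠ j₂ := by simp [hj₁, hj₂]
  have n₁₃ : j₁ ≠ j₃ := by simp [hj₁, hj₃]
  have n₂₃ : j₂ ≠ j₃ := by simp [hj₂, hj₃]
  obtain ⟨f, hf⟩ := hupdate x₀ y₀ ⟨hy₀, fun i _ => ⟨rfl, rfl⟩⟩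
  have hRf : ∀ v, R v (f v) := fun v => ⟨_, _, hf v j₁ l₁, j₁, l₁, by simp, by simp⟩
  refine ⟨f, fun v => ((hbisim _ _ (hRf v)).1.1).symm, fun v => ?_⟩
  have hv := hf v j₁ l₁
  set x₁ := Function.update x₀ j₁ v with hx₁
  set y₁ := Function.update y₀ j₁ (f v) with hy₁
  have e1 : x₁ j₁ = v := by simp [hx₁]
  have e2 : y₁ j₁ = f v := by simp [hy₁]
  obtain ⟨g, hg⟩ := hupdate x₁ y₁ hv
  refine ⟨g.trans f.symm, fun z => ?_⟩
  have hz := hg z j₂ l₂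
  obtain ⟨-, p1⟩ := hpair x₁ y₁ j₁ j₂ z (g z) n₁₂ hz
  set x₂ := Function.update x₁ j₂ z with hx₂
  set y₂ := Function.update y₁ j₂ (g z) with hy₂
  have e3 : x₂ j₁ = v := by rw [hx₂, Function.update_of_ne n₁₂, e1]
  have e4 : y₂ j₁ = f v := by rw [hy₂, Function.update_of_ne n₁₂, e2]
  have e5 : x₂ j₂ = z := by simp [hx₂]
  have e6 : y₂ j₂ = g z := by simp [hy₂]
  rw [e1, e2] at p1
  obtain ⟨h, hh⟩ := hupdate x₂ y₂ hz
  have hs : ∀ a b, R a b → refinement G χ T a (f.symm b) := fun a b hab =>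
    hcomp a _ b hab (by simpa using hRf (f.symm b))
  refine ⟨hs _ _ ⟨_, _, hz, j₂, l₂, e5, e6⟩, by simpa using p1, h.trans f.symm, fun y => ?_⟩
  have hy := hh y j₃ l₃
  obtain ⟨q1, q2⟩ := hpair x₂ y₂ j₁ j₃ y (h y) n₁₃ hy
  obtain ⟨q3, q4⟩ := hpair x₂ y₂ j₂ j₃ y (h y) n₂₃ hy
  rw [e3, e4] at q1 q2
  rw [e5, e6] at q3 q4
  refine ⟨hs _ _ ⟨_, _, hy, j₃, l₃, by simp, by simp⟩, ?_, ?_, ?_, ?_⟩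
  · rw [q1, Equiv.trans_apply, Equiv.symm_apply_eq]
  · rw [q3, Equiv.trans_apply, Equiv.trans_apply, EmbeddingLike.apply_eq_iff_eq]
  · simpa using q2
  · simpa using q4

theorem Stuck.identifies [Fintype V] [Nonempty V] {G : SimpleGraph V} {χ : V → C}
    {S T : Finset V} (h : Stuck G χ S T) {k : ℕ} (hk : #T + 3 ≤ k) : Identifies k G χ := by
  intro W _ _ H ψ hiso
  by_contra hd
  obtain ⟨E, hE, hne⟩ := exists_isTupleBisim (by omega) hd
  obtain ⟨f, hf, ht⟩ := exists_pairTransfer hE hne T hk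
  obtain ⟨φ, hφ⟩ := h.exists_iso ht
  refine hiso ⟨φ.trans (SimpleGraph.Iso.comap f H), fun x => ?_⟩
  exact (hf (φ x)).trans (refinement_color (hφ x)).symm

/-- The source of 2/3. The constraint on T survives adding one vertex that gains two classes (3 ≤ 4)
and two vertices that gain three (6 = 6), so a maximal count leaves neither move. -/
theorem exists_stuck [Fintype V] (G : SimpleGraph V) (χ : V → C) (S : Finset V)
    (hS : ∀ u v, G.Adj u v → u ∉ S → v ∈ S)
    (hmin : ∀ S' : Finset V, (∀ u v, G.Adj u v → u ∉ S' → v ∈ S') → #S ≤ #S') :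
    ∃ T, Stuck G χ S T ∧ 3 * #T ≤ 2 * #S := by
  obtain ⟨T, hT, hmax⟩ := exists_max_image
    (univ.filter fun T : Finset V => 3 * #T ≤ 2 * #(insideClasses (refinement G χ T) S))
    (fun T => #(insideClasses (refinement G χ T) S)) ⟨∅, by simp⟩
  simp only [mem_filter, mem_univ, true_and] at hT hmax
  refine ⟨T, ⟨hS, hmin, fun x => ?_, fun x y => ?_⟩, ?_⟩
  · by_contra! hlt
    have h1 := card_insert_le x T
    have h2 := hmax (insert x T) (by omega)
    omega
  · by_contra! hlt
    have h1 := card_insert_le y T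
    have h2 := card_insert_le x (insert y T)
    have h3 := hmax (insert x (insert y T)) (by omega)
    omega
  · have := card_insideClasses_le (refinement G χ T) S
    omega

theorem identifies_of_vertexCoverNum_eq [Fintype V] [Nonempty V] (G : SimpleGraph V) (χ : V → C)
    {r : ℕ} (hr : G.vertexCoverNum = r) : Identifies (2 * r / 3 + 3) G χ := by
  obtain ⟨c, hc, hcov⟩ := G.vertexCoverNum_exists
  have hcard : #c.toFinset = r := by
    rw [hr, Set.encard_eq_coe_toFinset_card] at hc
    exact_mod_cast hc
  obtain ⟨T, hT, hle⟩ := exists_stuck G χ c.toFinset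
    (fun u v huv hu => by
      rw [Set.mem_toFinset] at hu ⊢
      exact (hcov huv).resolve_left hu)
    (fun S' hS' => by
      have h1 : G.IsVertexCover (S' : Set V) := fun u v huv => by
        by_cases hu : u ∈ S'
        · exact Or.inl hu
        · exact Or.inr (hS' u v huv hu)
      have h2 := h1.vertexCoverNum_le
      rw [hr, Set.encard_coe_eq_coe_finsetCard] at h2
      rw [hcard]
      exact_mod_cast h2)
  exact hT.identifies (by omega)

end

end WeisfeilerLeman

theorem theorem3 {V : Type*} [Fintype V] [Nonempty V] {C : Type*}
    (G : SimpleGraph V) (χ : V → C) (r : ℕ) (hr : G.vertexCoverNum = r) :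
    ∃ d : ℕ, WeisfeilerLeman.IsWLDimension G χ d ∧ (d : ℚ) ≤ 2 / 3 * r + 3 := by
  have hk := WeisfeilerLeman.identifies_of_vertexCoverNum_eq G χ hr
  have hmem : 2 * r / 3 + 3 ∈ {k : ℕ | 1 ≤ k ∧ WeisfeilerLeman.Identifies k G χ} :=
    ⟨by omega, hk⟩
  refine ⟨sInf {k : ℕ | 1 ≤ k ∧ WeisfeilerLeman.Identifies k G χ},
    ⟨Nat.sInf_mem ⟨_, hmem⟩, fun k hk => Nat.sInf_le hk⟩, ?_⟩
  have h1 : sInf {k : ℕ | 1 ≤ k ∧ WeisfeilerLeman.Identifies k G χ} ≤ 2 * r / 3 + 3 :=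
    Nat.sInf_le hmem
  have h2 : 3 * (sInf {k : ℕ | 1 ≤ k ∧ WeisfeilerLeman.Identifies k G χ}) ≤ 2 * r + 9 := by
    omega
  have h3 : (3 : ℚ) * (sInf {k : ℕ | 1 ≤ k ∧ WeisfeilerLeman.Identifies k G χ} : ℕ) ≤
      2 * r + 9 := by exact_mod_cast h2
  linarith
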